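/- Let $U=\mathbf C\setminus((-\infty,0]\cup[1,\infty))$. Let ${}_2F_1(\tfrac12,\tfrac12;1;z)$ denote the analytic continuation of the hypergeometric series to $\mathbf C\setminus[1,\infty)$, given there by $\frac1\pi\int_0^1\frac{dt}{\sqrt{t(1-t)(1-tz)}}$ (principal square root), and for $z\in U$ put $$\lambda^{-1}(z)=i\,\frac{{}_2F_1(\frac12,\frac12;1;1-z)}{{}_2F_1(\frac12,\frac12;1;z)},\qquad H_{c,h}(z)=\Bigl(\frac1{z(1-z)}\Bigr)^{c/24}e^{2\pi i(-\frac c{24}+h)\lambda^{-1}(z)},$$ where the power is the holomorphic branch on $U$ that is positive on $(0,1)$. Let $$A_8(z)=\frac{(1-z)(2z^2+z+2)}{z^2},\qquad A_{24}(z)=\frac{(1-z)^3(2z^2+3z+2)}{z^2},\qquad B_c(z)=-(1-z)^{\frac c8-2}A_c\Bigl(\frac z{z-1}\Bigr)$$ for $c=8,24$. For a function $\varphi$ on $U$ for which both integrals exist, let $$\mathcal D_c[\varphi]=\int_{1/2}^1\varphi(z)A_c(z)\,dz+\frac12\int_{1/2}^{1/2+i\infty}\varphi(z)B_c(z)\,dz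 ,$$ the second integral being taken along the vertical half-line, and let $f_c(h)=\mathcal D_c[\varphi_{c,h}]$ with $\varphi_{c,h}(z)=H_{c,h}(z)-H_{c,h}(1-z)$. **Theorem.** Let $c=8$ or $c=24$. For every real $h\ge\frac c{16}+\frac12$ the two integrals defining $f_c(h)$ converge absolutely, and $f_c(h)$ is real and non-negative. Moreover $f_c(h)=0$ for $h=\frac c{16}+\frac12+n$, $n=0,1,2,\dots$. -/

import Mathlib

open MeasureTheory Set

noncomputable section

/-- The function `₂F₁(1/2, 1/2; 1; z)` on the slit plane `ℂ ∖ [1, ∞)`, given by Euler's integral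
`π ₂F₁(1/2, 1/2; 1; z) = ∫₀¹ dt / √(t (1 - t) (1 - t z))` with the principal square root.
(Mathlib's `₂F₁` is the sum of the power series, which is a junk value for `1 < ‖z‖`.)  That this
is the analytic continuation of the series is proved in `hyperF_eq_ordinaryHypergeometric` and
`differentiableOn_hyperF`. -/
def hyperF (z : ℂ) : ℂ :=
  (1 / (Real.pi : ℂ)) *
    ∫ t in (0 : ℝ)..1, 1 / ((t : ℂ) * (1 - (t : ℂ)) * (1 - (t : ℂ) * z)) ^ (1 / 2 : ℂ)

theorem hyperF_integrand {t : ℝ} (ht : t ∈ Ioo (0 : ℝ) 1) {z : ℂ}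
    (hz : 1 - (t : ℂ) * z ∈ Complex.slitPlane) :
    1 / ((t : ℂ) * (1 - (t : ℂ)) * (1 - (t : ℂ) * z)) ^ (1 / 2 : ℂ) =
      ((t * (1 - t)) ^ (-(1 / 2) : ℝ) : ℝ) * (1 - (t : ℂ) * z) ^ (-(1 / 2) : ℂ) := by
  have h0 : 0 < t * (1 - t) := mul_pos ht.1 (by linarith [ht.2])
  have h1 : (1 - (t : ℂ) * z) ≠ 0 := Complex.slitPlane_ne_zero hz
  have e : (t : ℂ) * (1 - (t : ℂ)) * (1 - (t : ℂ) * z) =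
      ((t * (1 - t) : ℝ) : ℂ) * (1 - (t : ℂ) * z) := by push_cast; ring
  have h2 : ((t * (1 - t) : ℝ) : ℂ) ≠ 0 := by exact_mod_cast h0.ne'
  rw [e, one_div, ← Complex.cpow_neg, Complex.cpow_def_of_ne_zero (mul_ne_zero h2 h1),
    Complex.log_ofReal_mul h0 h1, add_mul, Complex.exp_add, Complex.cpow_def_of_ne_zero h1,
    Complex.ofReal_cpow h0.le, Complex.cpow_def_of_ne_zero h2, Complex.ofReal_log h0.le]
  push_cast
  rfl

theorem hyperF_slit {t : ℝ} (ht : t ∈ Icc (0 : ℝ) 1) {z : ℂ}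
    (hz : 1 - z ∈ Complex.slitPlane) : 1 - (t : ℂ) * z ∈ Complex.slitPlane := by
  have h := Complex.starConvex_one_slitPlane hz (a := 1 - t) (b := t) (by linarith [ht.2]) ht.1
    (by ring)
  have e : (1 - t) • (1 : ℂ) + t • (1 - z) = 1 - (t : ℂ) * z := by
    simp only [Complex.real_smul]; push_cast; ring
  rwa [e] at h

theorem hyperF_eq_integral {z : ℂ} (hz : 1 - z ∈ Complex.slitPlane) :
    hyperF z = (1 / (Real.pi : ℂ)) * ∫ t in (0 : ℝ)..1,
      (((t * (1 - t)) ^ (-(1 / 2) : ℝ) : ℝ) : ℂ) * (1 - (t : ℂ) * z) ^ (-(1 / 2) : ℂ) := by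
  unfold hyperF
  congr 1
  rw [intervalIntegral.integral_of_le zero_le_one, intervalIntegral.integral_of_le zero_le_one,
    integral_Ioc_eq_integral_Ioo, integral_Ioc_eq_integral_Ioo]
  exact setIntegral_congr_fun measurableSet_Ioo fun t ht =>
    hyperF_integrand ht (hyperF_slit (Ioo_subset_Icc_self ht) hz)

theorem hyperF_weight (n : ℕ) {t : ℝ} (ht : t ∈ Ioo (0 : ℝ) 1) :
    (((t * (1 - t)) ^ (-(1 / 2) : ℝ) : ℝ) : ℂ) * (t : ℂ) ^ n =
      (t : ℂ) ^ (((n : ℂ) + 1 / 2) - 1) * (1 - (t : ℂ)) ^ ((1 / 2 : ℂ) - 1) := by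
  have h1 : (0 : ℝ) < 1 - t := by linarith [ht.2]
  have ht0 : (t : ℂ) ≠ 0 := by exact_mod_cast ht.1.ne'
  rw [Real.mul_rpow ht.1.le h1.le, Complex.ofReal_mul, Complex.ofReal_cpow ht.1.le,
    Complex.ofReal_cpow h1.le]
  have e : ((n : ℂ) + 1 / 2) - 1 = (n : ℂ) + (((-(1 / 2) : ℝ)) : ℂ) := by push_cast; ring
  rw [e, Complex.cpow_add _ _ ht0, Complex.cpow_natCast]
  have e2 : (1 / 2 : ℂ) - 1 = (((-(1 / 2) : ℝ)) : ℂ) := by push_cast; ring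
  rw [e2]
  push_cast
  ring

theorem hyperF_weight_integrable :
    IntervalIntegrable (fun t : ℝ => (t * (1 - t)) ^ (-(1 / 2) : ℝ)) volume 0 1 := by
  have h := Complex.betaIntegral_convergent (u := 1 / 2) (v := 1 / 2) (by norm_num) (by norm_num)
  have h2 : IntervalIntegrable (fun t : ℝ => (((t * (1 - t)) ^ (-(1 / 2) : ℝ) : ℝ) : ℂ))
      volume 0 1 := by
    rw [intervalIntegrable_iff_integrableOn_Ioo_of_le zero_le_one] at h ⊢
    refine h.congr_fun (fun t ht => ?_) measurableSet_Ioo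
    simpa using (hyperF_weight 0 ht).symm
  rw [intervalIntegrable_iff] at h2 ⊢
  exact h2.re

theorem hyperF_gamma (n : ℕ) : Complex.Gamma ((n : ℂ) + 1 / 2) =
    (ascPochhammer ℂ n).eval (1 / 2) * Complex.Gamma (1 / 2) := by
  induction n with
  | zero => simp
  | succ n ih =>
    have e : ((n + 1 : ℕ) : ℂ) + 1 / 2 = ((n : ℂ) + 1 / 2) + 1 := by push_cast; ring
    have hne : (n : ℂ) + 1 / 2 ≠ 0 := by
      intro h
      have := congrArg Complex.re h
      simp at this
      have hn : (0 : ℝ) ≤ n := Nat.cast_nonneg n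
      linarith
    rw [e, Complex.Gamma_add_one _ hne, ih, ascPochhammer_succ_eval]
    ring

theorem hyperF_beta (n : ℕ) : Complex.betaIntegral ((n : ℂ) + 1 / 2) (1 / 2) =
    Real.pi * ((n.factorial : ℂ)⁻¹ * (ascPochhammer ℂ n).eval (1 / 2)) := by
  have hre : 0 < ((n : ℂ) + 1 / 2).re := by
    have hn : (0 : ℝ) ≤ n := Nat.cast_nonneg n
    simp
    linarith
  have h := Complex.Gamma_mul_Gamma_eq_betaIntegral (s := (n : ℂ) + 1 / 2) (t := 1 / 2) hre
    (by norm_num)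
  have e : (n : ℂ) + 1 / 2 + 1 / 2 = (n : ℂ) + 1 := by ring
  have hg : Complex.Gamma (1 / 2) * Complex.Gamma (1 / 2) = Real.pi := by
    have := Complex.Gamma_mul_Gamma_one_sub (1 / 2)
    have e3 : (Real.pi : ℂ) * (1 / 2) = (Real.pi : ℂ) / 2 := by ring
    rw [e3, Complex.sin_pi_div_two] at this
    norm_num at this ⊢
    exact this
  rw [e, Complex.Gamma_nat_eq_factorial, hyperF_gamma, mul_assoc, hg] at h
  have hf : (n.factorial : ℂ) ≠ 0 := by exact_mod_cast n.factorial_ne_zero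
  have h' := h.symm
  rw [mul_comm, ← eq_div_iff hf] at h'
  rw [h', div_eq_mul_inv]
  ring

theorem hyperF_binomial {w : ℂ} (hw : ‖w‖ < 1) :
    HasSum (fun n : ℕ => ((n.factorial : ℂ)⁻¹ * (ascPochhammer ℂ n).eval (1 / 2)) * w ^ n)
        ((1 - w) ^ (-(1 / 2) : ℂ)) ∧
      Summable (fun n : ℕ =>
        ‖((n.factorial : ℂ)⁻¹ * (ascPochhammer ℂ n).eval (1 / 2))‖ * ‖w‖ ^ n) := by
  have key : ∀ v : ℂ, ‖v‖ < 1 →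
      HasSum (fun n : ℕ => ((n.factorial : ℂ)⁻¹ * (ascPochhammer ℂ n).eval (1 / 2)) * v ^ n)
        ((1 - v) ^ (-(1 / 2) : ℂ)) := by
    intro v hv
    have h := (Complex.one_add_cpow_hasFPowerSeriesOnBall_zero (a := (-(1 / 2) : ℂ))).hasSum
      (y := -v) (by
        rw [← ENNReal.ofReal_one, Metric.eball_ofReal]; simpa using hv)
    rw [zero_add, ← sub_eq_add_neg] at h
    have hb : ∀ k : ℕ, (k : ℂ) ≠ -1 := by
      intro k hk
      have := congrArg Complex.re hk
      simp at this
      have hn : (0 : ℝ) ≤ k := Nat.cast_nonneg k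
      linarith
    rw [binomialSeries_eq_ordinaryHypergeometricSeries hb] at h
    have e : (fun n : ℕ => ((n.factorial : ℂ)⁻¹ * (ascPochhammer ℂ n).eval (1 / 2)) * v ^ n) =
        fun n => ((ordinaryHypergeometricSeries ℂ (- -(1 / 2) : ℂ) 1 1).compContinuousLinearMap
          (-(.id _ _))) n fun _ => -v := by
      funext n
      have hf : (n.factorial : ℂ) ≠ 0 := by exact_mod_cast n.factorial_ne_zero
      rw [FormalMultilinearSeries.compContinuousLinearMap_apply]
      have e2 : (⇑(-(.id ℂ ℂ : ℂ →L[ℂ] ℂ)) ∘ fun _ : Fin n => -v) = fun _ => v := by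
        funext i
        simp
      rw [e2, ordinaryHypergeometricSeries_apply_eq, neg_neg, ascPochhammer_eval_one, smul_eq_mul]
      field_simp
    rw [e]
    exact h
  refine ⟨key w hw, ?_⟩
  have := (key (‖w‖ : ℂ) (by simpa using hw)).summable.norm
  simpa using this

/-- On the unit disc `hyperF` is the sum of the hypergeometric series. -/
theorem hyperF_eq_ordinaryHypergeometric {z : ℂ} (hz : ‖z‖ < 1) :
    hyperF z = ordinaryHypergeometric (1 / 2 : ℂ) (1 / 2) 1 z := by
  have hslit : 1 - z ∈ Complex.slitPlane := by
    have := Complex.mem_slitPlane_of_norm_lt_one (z := -z) (by simpa using hz)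
    rwa [← sub_eq_add_neg] at this
  have hpi : (Real.pi : ℂ) ≠ 0 := by exact_mod_cast Real.pi_ne_zero
  set a : ℕ → ℂ := fun n => (n.factorial : ℂ)⁻¹ * (ascPochhammer ℂ n).eval (1 / 2) with ha
  set w : ℝ → ℝ := fun t => (t * (1 - t)) ^ (-(1 / 2) : ℝ) with hw
  have hw0 : ∀ t ∈ Ioo (0 : ℝ) 1, 0 ≤ w t := fun t ht =>
    Real.rpow_nonneg (mul_nonneg ht.1.le (by linarith [ht.2])) _
  have hint : ∀ n : ℕ, IntegrableOn (fun t : ℝ => (w t : ℂ) * (a n * ((t : ℂ) * z) ^ n))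
      (Ioo 0 1) := by
    intro n
    have h := Complex.betaIntegral_convergent (u := (n : ℂ) + 1 / 2) (v := 1 / 2) (by
      have hn : (0 : ℝ) ≤ n := Nat.cast_nonneg n
      simp
      linarith) (by norm_num)
    rw [intervalIntegrable_iff_integrableOn_Ioo_of_le zero_le_one] at h
    refine IntegrableOn.congr_fun (h.const_mul (a n * z ^ n)) (fun t ht => ?_) measurableSet_Ioo
    rw [← hyperF_weight n ht, mul_pow]
    ring
  have hval : ∀ n : ℕ, ∫ t in Ioo (0 : ℝ) 1, (w t : ℂ) * (a n * ((t : ℂ) * z) ^ n) =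
      Real.pi * (a n * a n * z ^ n) := by
    intro n
    have h := hyperF_beta n
    rw [Complex.betaIntegral, intervalIntegral.integral_of_le zero_le_one,
      integral_Ioc_eq_integral_Ioo] at h
    calc _ = ∫ t in Ioo (0 : ℝ) 1, (a n * z ^ n) *
          ((t : ℂ) ^ (((n : ℂ) + 1 / 2) - 1) * (1 - (t : ℂ)) ^ ((1 / 2 : ℂ) - 1)) := by
          refine setIntegral_congr_fun measurableSet_Ioo fun t ht => ?_
          rw [← hyperF_weight n ht, mul_pow]
          ring
      _ = _ := by rw [integral_const_mul, h]; ring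
  have hsum := hasSum_integral_of_dominated_convergence (μ := volume.restrict (Ioo (0 : ℝ) 1))
    (F := fun (n : ℕ) (t : ℝ) => (w t : ℂ) * (a n * ((t : ℂ) * z) ^ n))
    (f := fun t : ℝ => (w t : ℂ) * (1 - (t : ℂ) * z) ^ (-(1 / 2) : ℂ))
    (fun n t => w t * (‖a n‖ * ‖z‖ ^ n)) (fun n => (hint n).aestronglyMeasurable)
    (fun n => by
      filter_upwards [self_mem_ae_restrict measurableSet_Ioo] with t ht
      rw [norm_mul, norm_mul (a n), norm_pow, norm_mul (t : ℂ), Complex.norm_real,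
        Complex.norm_real, Real.norm_of_nonneg (hw0 t ht), Real.norm_of_nonneg ht.1.le]
      have h1 : t * ‖z‖ ≤ ‖z‖ := mul_le_of_le_one_left (norm_nonneg z) ht.2.le
      have h2 := hw0 t ht
      have h3 : 0 ≤ t * ‖z‖ := mul_nonneg ht.1.le (norm_nonneg z)
      gcongr)
    (Filter.Eventually.of_forall fun t => ((hyperF_binomial hz).2).mul_left (w t))
    (by
      simp_rw [tsum_mul_left]
      have := hyperF_weight_integrable
      rw [intervalIntegrable_iff_integrableOn_Ioo_of_le zero_le_one] at this
      exact this.mul_const _)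
    (by
      filter_upwards [self_mem_ae_restrict measurableSet_Ioo] with t ht
      refine ((hyperF_binomial (w := (t : ℂ) * z) ?_).1).mul_left _
      rw [norm_mul, Complex.norm_real, Real.norm_of_nonneg ht.1.le]
      exact lt_of_le_of_lt (mul_le_of_le_one_left (norm_nonneg z) ht.2.le) hz)
  rw [hyperF_eq_integral hslit, intervalIntegral.integral_of_le zero_le_one,
    integral_Ioc_eq_integral_Ioo, ← hsum.tsum_eq, ordinaryHypergeometric_eq_tsum]
  simp_rw [hval, tsum_mul_left]
  rw [← mul_assoc, one_div_mul_cancel hpi, one_mul]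
  refine tsum_congr fun n => ?_
  simp only [ha, smul_eq_mul, ascPochhammer_eval_one]
  ring

/-- `hyperF` is holomorphic on `ℂ ∖ [1, ∞)`. -/
theorem differentiableOn_hyperF :
    DifferentiableOn ℂ hyperF {z : ℂ | 1 - z ∈ Complex.slitPlane} := by
  have hopen : IsOpen {z : ℂ | 1 - z ∈ Complex.slitPlane} :=
    Complex.isOpen_slitPlane.preimage (by fun_prop)
  intro z hz
  obtain ⟨r, hr, hball⟩ := Metric.nhds_basis_closedBall.mem_iff.1 (hopen.mem_nhds hz)
  refine DifferentiableAt.differentiableWithinAt ?_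
  have heq : hyperF =ᶠ[nhds z] fun z => (1 / (Real.pi : ℂ)) * ∫ t in (0 : ℝ)..1,
      (((t * (1 - t)) ^ (-(1 / 2) : ℝ) : ℝ) : ℂ) * (1 - (t : ℂ) * z) ^ (-(1 / 2) : ℂ) := by
    filter_upwards [hopen.mem_nhds hz] with y hy using hyperF_eq_integral hy
  refine DifferentiableAt.congr_of_eventuallyEq ?_ heq
  refine DifferentiableAt.const_mul ?_ _
  set w : ℝ → ℝ := fun t => (t * (1 - t)) ^ (-(1 / 2) : ℝ) with hw
  have hwi : IntervalIntegrable w volume 0 1 := hyperF_weight_integrable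
  have hU : uIoc (0 : ℝ) 1 = Ioc 0 1 := uIoc_of_le zero_le_one
  have hslit : ∀ p ∈ Metric.closedBall z r ×ˢ Icc (0 : ℝ) 1,
      1 - (p.2 : ℂ) * p.1 ∈ Complex.slitPlane := fun p hp => hyperF_slit hp.2 (hball hp.1)
  have hcont : ∀ e : ℂ, ContinuousOn (fun p : ℂ × ℝ => (1 - (p.2 : ℂ) * p.1) ^ e)
      (Metric.closedBall z r ×ˢ Icc (0 : ℝ) 1) := fun e =>
    ContinuousOn.cpow_const (by fun_prop) hslit
  have hK : IsCompact (Metric.closedBall z r ×ˢ Icc (0 : ℝ) 1) :=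
    (isCompact_closedBall z r).prod isCompact_Icc
  obtain ⟨M, hM⟩ := hK.exists_bound_of_continuousOn
    (f := fun p : ℂ × ℝ => (1 / 2 : ℂ) * (p.2 : ℂ) * (1 - (p.2 : ℂ) * p.1) ^ (-(1 / 2) - 1 : ℂ))
    (ContinuousOn.mul (by fun_prop) (hcont _))
  have hslice : ∀ y ∈ Metric.closedBall z r, ∀ e : ℂ,
      ContinuousOn (fun t : ℝ => (1 - (t : ℂ) * y) ^ e) (Icc 0 1) := fun y hy e =>
    (hcont e).comp (f := fun t : ℝ => (y, t)) (by fun_prop) fun t ht => ⟨hy, ht⟩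
  have hwm : Measurable fun t : ℝ => (w t : ℂ) := by fun_prop
  have hmeas : ∀ y ∈ Metric.closedBall z r, ∀ e : ℂ, AEStronglyMeasurable
      (fun t : ℝ => (1 - (t : ℂ) * y) ^ e) (volume.restrict (uIoc 0 1)) := fun y hy e => by
    rw [hU]
    exact ((hslice y hy e).mono Ioc_subset_Icc_self).aestronglyMeasurable measurableSet_Ioc
  have hzz : z ∈ Metric.closedBall z r := Metric.mem_closedBall_self hr.le
  have h := intervalIntegral.hasDerivAt_integral_of_dominated_loc_of_deriv_le (μ := volume)
    (a := (0 : ℝ)) (b := 1) (𝕜 := ℂ)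
    (F := fun (y : ℂ) (t : ℝ) => (w t : ℂ) * (1 - (t : ℂ) * y) ^ (-(1 / 2) : ℂ))
    (F' := fun (y : ℂ) (t : ℝ) =>
      (w t : ℂ) * ((1 / 2 : ℂ) * (t : ℂ) * (1 - (t : ℂ) * y) ^ (-(1 / 2) - 1 : ℂ)))
    (x₀ := z) (s := Metric.closedBall z r) (bound := fun t => |w t| * M)
    (Metric.closedBall_mem_nhds z hr)
    (by
      filter_upwards [Metric.closedBall_mem_nhds z hr] with y hy
      exact hwm.aestronglyMeasurable.mul (hmeas y hy _))
    (by
      have h1 : IntervalIntegrable (fun t => (w t : ℂ)) volume 0 1 := by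
        rw [intervalIntegrable_iff] at hwi ⊢
        exact hwi.ofReal
      refine h1.mul_continuousOn ?_
      rw [uIcc_of_le zero_le_one]
      exact hslice z hzz _)
    (hwm.aestronglyMeasurable.mul
      (AEStronglyMeasurable.mul (by fun_prop) (hmeas z hzz _)))
    (Filter.Eventually.of_forall fun t ht y hy => by
      rw [hU] at ht
      rw [norm_mul, Complex.norm_real, Real.norm_eq_abs]
      exact mul_le_mul_of_nonneg_left (hM (y, t) ⟨hy, Ioc_subset_Icc_self ht⟩) (abs_nonneg _))
    (hwi.abs.mul_const M)
    (Filter.Eventually.of_forall fun t ht y hy => by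
      rw [hU] at ht
      refine HasDerivAt.const_mul _ ?_
      have h1 : HasDerivAt (fun y : ℂ => 1 - (t : ℂ) * y) (-((t : ℂ) * 1)) y :=
        ((hasDerivAt_id y).const_mul (t : ℂ)).const_sub 1
      refine (h1.cpow_const (c := (-(1 / 2) : ℂ))
        (hslit (y, t) ⟨hy, Ioc_subset_Icc_self ht⟩)).congr_deriv ?_
      ring)
  exact h.2.differentiableAt

/-- The branch `λ⁻¹(z) = i ₂F₁(1/2, 1/2; 1; 1 - z) / ₂F₁(1/2, 1/2; 1; z)` of the inverse of the
modular `λ`-function on the doubly slit plane `U = ℂ ∖ ((-∞, 0] ∪ [1, ∞))`. -/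
def lambdaInv (z : ℂ) : ℂ :=
  Complex.I * hyperF (1 - z) / hyperF z

/-- `H_{c,h}(z) = (1 / (z (1 - z)))^{c/24} exp(2πi (-c/24 + h) λ⁻¹(z))` on `U`.  For `z ∈ U` the
number `z (1 - z)` is not in `(-∞, 0]`, so the principal power is the holomorphic branch on `U`
that is positive on `(0, 1)`. -/
def confH (c h : ℝ) (z : ℂ) : ℂ :=
  (1 / (z * (1 - z))) ^ ((c / 24 : ℝ) : ℂ) *
    Complex.exp (2 * (Real.pi : ℂ) * Complex.I * ((-(c / 24) + h : ℝ) : ℂ) * lambdaInv z)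

/-- `φ | (id - S)`, where `S` acts on functions of `z` through `z ↦ 1 - z`. -/
def slashIdSubS (φ : ℂ → ℂ) (z : ℂ) : ℂ :=
  φ z - φ (1 - z)

/-- The rational functions `A_8` and `A_24`; other values of `c` are not used. -/
def magicA (c : ℕ) (z : ℂ) : ℂ :=
  if c = 8 then (1 - z) * (2 * z ^ 2 + z + 2) / z ^ 2
  else if c = 24 then (1 - z) ^ 3 * (2 * z ^ 2 + 3 * z + 2) / z ^ 2
  else 0

/-- `B_c(z) = -(1 - z)^{c/8 - 2} A_c(z | T)`, where `T` acts through `z ↦ z / (z - 1)`. The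
exponent is `-1` for `c = 8` and `1` for `c = 24`. -/
def magicB (c : ℕ) (z : ℂ) : ℂ :=
  -((1 - z) ^ (((c / 8 : ℕ) : ℤ) - 2) * magicA c (z / (z - 1)))

/-- Existence, as absolutely convergent integrals, of the two integrals in `contourD c φ`. -/
def ContourDExists (c : ℕ) (φ : ℂ → ℂ) : Prop :=
  IntervalIntegrable (fun x : ℝ => φ (x : ℂ) * magicA c (x : ℂ)) volume (1 / 2) 1 ∧
    IntegrableOn (fun t : ℝ => φ (1 / 2 + (t : ℂ) * Complex.I) *
      magicB c (1 / 2 + (t : ℂ) * Complex.I) * Complex.I) (Ioi 0)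

/-- The functional
`D_c[φ] = ∫_{1/2}^1 φ(z) A_c(z) dz + (1/2) ∫_{1/2}^{1/2 + i∞} φ(z) B_c(z) dz`;
the second path is parametrized by `z = 1/2 + i t`, `t > 0`. -/
def contourD (c : ℕ) (φ : ℂ → ℂ) : ℂ :=
  (∫ x in (1 / 2 : ℝ)..1, φ (x : ℂ) * magicA c (x : ℂ)) +
    (1 / 2) * ∫ t in Ioi (0 : ℝ), φ (1 / 2 + (t : ℂ) * Complex.I) *
      magicB c (1 / 2 + (t : ℂ) * Complex.I) * Complex.I

/-- `f_c(h) = D_c[H_{c,h} | (id - S)]`. -/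
def contourF (c : ℕ) (h : ℝ) : ℂ :=
  contourD c (slashIdSubS (confH c h))

end

/-! Write H for `confH c h`, A and B for `magicA c` and `magicB c`, and e = exp(2πi(h - c/16)). The
functional can be evaluated because of three symmetries. (1) The map z ↦ z/(z-1) shifts λ⁻¹ by -1 on
the upper half-plane. Hence H B dz is there e times the pullback of H A dz (`confH_pfaff`,
`confH_mul_magicB`). (2) There are rational identities B(1-z) = B(z) and A(z) + B(z) = -A(1-z)
(`magicB_one_sub`, `magicA_add_magicB`). (3) All functions commute with complex conjugation.

Let P_A, P_B be the primitives of H A, H B vanishing at 1/2. By (2) the first integral is the limit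
of P_A(1-q) - P_A(q) - P_B(q) as q → 0+; by (2) and (3) the second term is the limit of Re
P_B(1/2+iT). Put p = 1/(1/2-iT) and q = |p|. The map z/(z-1) sends 1/2+iT to 1-p and p to its
conjugate, so (1) gives P_B(1/2+iT) = P_B(p) + e(P_A(1-p) - conj P_A(p)). Since H A is bounded near
1 and H(A+B) is bounded near 0, replacing p by q costs O(q) in P_A(1-p) and in P_A+P_B. Thus f_c(h)
is the limit of Re[(P_A(1-q) - P_A(p)) + e(P_A(1-q) - conj P_A(p))] (`abs_truncF_re_sub_le`).

If h = c/16 + 1/2 + n, then e = -1 and the bracket is purely imaginary, so f_c(h) = 0. If h > c/16 +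
1/2, then H A = O(|z|^(κ-1)) at 0 with κ > 0, so P_A(p) may be replaced by the real number P_A(q).
What remains is (1 + Re e) times the integral of the non-negative function H A over (q, 1-q). The
threshold value of h is the case n = 0.

The analytic input concerns F = `hyperF`. The shift of λ⁻¹ follows from Pfaff's transformation and
the connection formula `hyperF_inv`, which is Cauchy's theorem for an elliptic differential on the
triangle 0, 1, 1/u. The size of H follows from |Im F| ≤ Re F for Re z < 1 and from the logarithmic
growth of F at 1. -/

noncomputable section

/-! ### Primitives on star-shaped domains. -/

/-- The integral of `f` along the segment from `a` to `z`. -/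
def segmentPrimitive (f : ℂ → ℂ) (a z : ℂ) : ℂ :=
  ∫ v in (0 : ℝ)..1, (z - a) * f (a + (v : ℂ) * (z - a))

theorem segmentPrimitive_mem {U : Set ℂ} {a : ℂ} (hs : StarConvex ℝ a U) {z : ℂ} (hz : z ∈ U)
    {v : ℝ} (hv : v ∈ Icc (0 : ℝ) 1) : a + (v : ℂ) * (z - a) ∈ U := by
  have h := hs hz (a := 1 - v) (b := v) (by linarith [hv.2]) hv.1 (by ring)
  have e : (1 - v) • a + v • z = a + (v : ℂ) * (z - a) := by
    simp only [Complex.real_smul]; push_cast; ring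
  rwa [e] at h

/-- Differentiation under the integral sign produces the v-derivative of v f(a + v(z-a)), whose
integral over [0,1] is f(z). -/
theorem hasDerivAt_segmentPrimitive {U : Set ℂ} (hU : IsOpen U) {a : ℂ} (hs : StarConvex ℝ a U)
    {f : ℂ → ℂ} (hf : DifferentiableOn ℂ f U) {z : ℂ} (hz : z ∈ U) :
    HasDerivAt (segmentPrimitive f a) (f z) z := by
  obtain ⟨r, hr, hball⟩ := Metric.nhds_basis_closedBall.mem_iff.1 (hU.mem_nhds hz)
  have hmem : ∀ p ∈ Metric.closedBall z r ×ˢ Icc (0 : ℝ) 1, a + (p.2 : ℂ) * (p.1 - a) ∈ U :=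
    fun p hp => segmentPrimitive_mem hs (hball hp.1) hp.2
  have hcf : ContinuousOn (fun p : ℂ × ℝ => f (a + (p.2 : ℂ) * (p.1 - a)))
      (Metric.closedBall z r ×ˢ Icc (0 : ℝ) 1) :=
    hf.continuousOn.comp (f := fun p : ℂ × ℝ => a + (p.2 : ℂ) * (p.1 - a)) (by fun_prop) hmem
  have hcf' : ContinuousOn (fun p : ℂ × ℝ => deriv f (a + (p.2 : ℂ) * (p.1 - a)))
      (Metric.closedBall z r ×ˢ Icc (0 : ℝ) 1) :=
    (hf.deriv hU).continuousOn.comp (f := fun p : ℂ × ℝ => a + (p.2 : ℂ) * (p.1 - a))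
      (by fun_prop) hmem
  have hcD : ContinuousOn (fun p : ℂ × ℝ => f (a + (p.2 : ℂ) * (p.1 - a)) +
      (p.1 - a) * (deriv f (a + (p.2 : ℂ) * (p.1 - a)) * (p.2 : ℂ)))
      (Metric.closedBall z r ×ˢ Icc (0 : ℝ) 1) := by
    refine hcf.add (ContinuousOn.mul (by fun_prop) (hcf'.mul (by fun_prop)))
  obtain ⟨M, hM⟩ := ((isCompact_closedBall z r).prod isCompact_Icc).exists_bound_of_continuousOn hcD
  have hzz : z ∈ Metric.closedBall z r := Metric.mem_closedBall_self hr.le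
  have hslice : ∀ y ∈ Metric.closedBall z r,
      ContinuousOn (fun v : ℝ => (y - a) * f (a + (v : ℂ) * (y - a))) (Icc 0 1) := fun y hy =>
    continuousOn_const.mul (hcf.comp (f := fun t : ℝ => (y, t)) (by fun_prop) fun t ht => ⟨hy, ht⟩)
  have hsliceD : ContinuousOn (fun v : ℝ => f (a + (v : ℂ) * (z - a)) +
      (z - a) * (deriv f (a + (v : ℂ) * (z - a)) * (v : ℂ))) (Icc 0 1) :=
    hcD.comp (f := fun t : ℝ => (z, t)) (by fun_prop) fun t ht => ⟨hzz, ht⟩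
  have hU' : uIoc (0 : ℝ) 1 = Ioc 0 1 := uIoc_of_le zero_le_one
  have hder : ∀ y ∈ Metric.closedBall z r, ∀ v ∈ Icc (0 : ℝ) 1,
      HasDerivAt f (deriv f (a + (v : ℂ) * (y - a))) (a + (v : ℂ) * (y - a)) := fun y hy v hv =>
    (hf.differentiableAt (hU.mem_nhds (hmem (y, v) ⟨hy, hv⟩))).hasDerivAt
  have h := intervalIntegral.hasDerivAt_integral_of_dominated_loc_of_deriv_le (μ := volume)
    (a := (0 : ℝ)) (b := 1) (𝕜 := ℂ)
    (F := fun (y : ℂ) (v : ℝ) => (y - a) * f (a + (v : ℂ) * (y - a)))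
    (F' := fun (y : ℂ) (v : ℝ) => f (a + (v : ℂ) * (y - a)) +
      (y - a) * (deriv f (a + (v : ℂ) * (y - a)) * (v : ℂ)))
    (x₀ := z) (s := Metric.closedBall z r) (bound := fun _ => M)
    (Metric.closedBall_mem_nhds z hr)
    (by
      filter_upwards [Metric.closedBall_mem_nhds z hr] with y hy
      rw [hU']
      exact ((hslice y hy).mono Ioc_subset_Icc_self).aestronglyMeasurable measurableSet_Ioc)
    (ContinuousOn.intervalIntegrable (by rw [uIcc_of_le zero_le_one]; exact hslice z hzz))
    (by
      rw [hU']
      exact (hsliceD.mono Ioc_subset_Icc_self).aestronglyMeasurable measurableSet_Ioc)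
    (Filter.Eventually.of_forall fun v hv y hy => by
      rw [hU'] at hv
      exact hM (y, v) ⟨hy, Ioc_subset_Icc_self hv⟩)
    (intervalIntegrable_const)
    (Filter.Eventually.of_forall fun v hv y hy => by
      rw [hU'] at hv
      have h1 : HasDerivAt (fun y : ℂ => a + (v : ℂ) * (y - a)) (v : ℂ) y := by
        simpa using (((hasDerivAt_id y).sub_const a).const_mul (v : ℂ)).const_add a
      have h2 := ((hasDerivAt_id y).sub_const a).mul
        ((hder y hy v (Ioc_subset_Icc_self hv)).comp y h1)
      exact h2.congr_deriv (by simp))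
  have hftc : ∫ v in (0 : ℝ)..1, (f (a + (v : ℂ) * (z - a)) +
      (z - a) * (deriv f (a + (v : ℂ) * (z - a)) * (v : ℂ))) = f z := by
    have := intervalIntegral.integral_eq_sub_of_hasDerivAt
      (f := fun v : ℝ => (v : ℂ) * f (a + (v : ℂ) * (z - a)))
      (f' := fun v : ℝ => f (a + (v : ℂ) * (z - a)) +
        (z - a) * (deriv f (a + (v : ℂ) * (z - a)) * (v : ℂ))) (a := 0) (b := 1)
      (fun v hv => by
        rw [uIcc_of_le zero_le_one] at hv
        have h0 : HasDerivAt (fun v : ℝ => (v : ℂ)) 1 v := Complex.ofRealCLM.hasDerivAt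
        have h1 : HasDerivAt (fun v : ℝ => a + (v : ℂ) * (z - a)) (z - a) v := by
          simpa using (h0.mul_const (z - a)).const_add a
        have h2 := h0.mul ((hder z hzz v hv).comp v h1)
        refine h2.congr_deriv ?_
        simp only [Function.comp_apply]
        ring)
      (ContinuousOn.intervalIntegrable (by rw [uIcc_of_le zero_le_one]; exact hsliceD))
    rw [this]
    simp
  have h2 := h.2
  rw [hftc] at h2
  exact h2

@[simp] theorem segmentPrimitive_self (f : ℂ → ℂ) (a : ℂ) : segmentPrimitive f a a = 0 := by
  simp [segmentPrimitive]

theorem segmentPrimitive_conj {U : Set ℂ} {a : ℂ} (hs : StarConvex ℝ a U) {f : ℂ → ℂ}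
    (ha : (starRingEnd ℂ) a = a)
    (hf : ∀ z ∈ U, f ((starRingEnd ℂ) z) = (starRingEnd ℂ) (f z)) {z : ℂ} (hz : z ∈ U) :
    segmentPrimitive f a ((starRingEnd ℂ) z) = (starRingEnd ℂ) (segmentPrimitive f a z) := by
  unfold segmentPrimitive
  rw [intervalIntegral.integral_of_le zero_le_one, intervalIntegral.integral_of_le zero_le_one,
    ← integral_conj]
  refine setIntegral_congr_fun measurableSet_Ioc fun v hv => ?_
  have := hf _ (segmentPrimitive_mem hs hz (Ioc_subset_Icc_self hv))
  simp only [map_add, map_mul, map_sub, Complex.conj_ofReal, ha] at this ⊢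
  rw [this]

/-- The mean value inequality along a segment. -/
theorem norm_sub_le_of_segment {f K : ℂ → ℂ} {x y : ℂ} {C : ℝ}
    (hd : ∀ z ∈ segment ℝ x y, HasDerivAt K (f z) z) (hb : ∀ z ∈ segment ℝ x y, ‖f z‖ ≤ C) :
    ‖K y - K x‖ ≤ C * ‖y - x‖ :=
  (convex_segment x y).norm_image_sub_le_of_norm_hasDerivWithin_le
    (fun z hz => (hd z hz).hasDerivWithinAt) hb (left_mem_segment ℝ x y) (right_mem_segment ℝ x y)

/-- If the derivative `f` is integrable up to the right end, its primitive converges there. -/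
theorem tendsto_of_hasDerivAt_of_integrable {f K : ℝ → ℂ} {a b : ℝ} {l : ℂ} (hab : a < b)
    (hd : ∀ x ∈ Ioo a b, HasDerivAt K (f x) x) (hi : IntervalIntegrable f volume a b)
    (hl : Filter.Tendsto K (nhdsWithin a (Ioi a)) (nhds l)) :
    Filter.Tendsto K (nhdsWithin b (Iio b)) (nhds (l + ∫ x in a..b, f x)) := by
  have hc : ContinuousWithinAt (fun x => ∫ y in a..x, f y) (Icc a b) b := by
    have := intervalIntegral.continuousOn_primitive_interval (f := f) (a := a) (b := b)
      (μ := volume) (by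
        rw [uIcc_of_le hab.le, integrableOn_Icc_iff_integrableOn_Ioc]
        exact (intervalIntegrable_iff_integrableOn_Ioc_of_le hab.le).1 hi)
    rw [uIcc_of_le hab.le] at this
    exact this b (right_mem_Icc.2 hab.le)
  have h1 : Filter.Tendsto (fun x => ∫ y in a..x, f y) (nhdsWithin b (Iio b))
      (nhds (∫ y in a..b, f y)) := by
    have h2 : nhdsWithin b (Ioo a b) ≤ nhdsWithin b (Icc a b) :=
      nhdsWithin_mono _ Ioo_subset_Icc_self
    rw [nhdsWithin_Ioo_eq_nhdsLT hab] at h2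
    exact hc.tendsto.mono_left h2
  refine (h1.const_add l).congr' ?_
  filter_upwards [Ioo_mem_nhdsLT hab] with x hx
  have := intervalIntegral.integral_eq_sub_of_hasDerivAt_of_tendsto (f := K) (f' := f) hx.1
    (fun y hy => hd y ⟨hy.1, hy.2.trans hx.2⟩)
    (hi.mono_set (by
      rw [uIcc_of_le hx.1.le, uIcc_of_le hab.le]
      exact Icc_subset_Icc_right hx.2.le)) hl
    ((hd x hx).continuousAt.tendsto.mono_left nhdsWithin_le_nhds)
  rw [this]
  ring

/-! ### Principal logarithms, powers and inverse square roots. -/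

theorem arg_nonpos_of_mem_slitPlane {x : ℂ} (hx : x ∈ Complex.slitPlane) (h : x.im ≤ 0) :
    x.arg ≤ 0 := by
  rcases h.lt_or_eq with h | h
  · exact (Complex.arg_neg_iff.2 h).le
  · rcases Complex.mem_slitPlane_iff.1 hx with h' | h'
    · exact (Complex.arg_eq_zero_iff.2 ⟨h'.le, h⟩).le
    · exact absurd h h'

/-- Arguments of opposite sign, each in (-π, π), have their sum in (-π, π), so no multiple of 2πi
appears. -/
theorem log_mul_of_im_mul_im_nonpos {x y : ℂ} (hx : x ∈ Complex.slitPlane)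
    (hy : y ∈ Complex.slitPlane) (h : x.im * y.im ≤ 0) :
    Complex.log (x * y) = Complex.log x + Complex.log y := by
  have hx' := Complex.mem_slitPlane_iff_arg.1 hx
  have hy' := Complex.mem_slitPlane_iff_arg.1 hy
  refine Complex.log_mul hx'.2 hy'.2 ?_
  have h1 := Complex.neg_pi_lt_arg x
  have h2 := Complex.neg_pi_lt_arg y
  have h3 := lt_of_le_of_ne (Complex.arg_le_pi x) hx'.1
  have h4 := lt_of_le_of_ne (Complex.arg_le_pi y) hy'.1
  rcases mul_nonpos_iff.1 h with ⟨ha, hb⟩ | ⟨ha, hb⟩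
  · have h5 := Complex.arg_nonneg_iff.2 ha
    have h6 := arg_nonpos_of_mem_slitPlane hy hb
    constructor <;> linarith
  · have h5 := Complex.arg_nonneg_iff.2 hb
    have h6 := arg_nonpos_of_mem_slitPlane hx ha
    constructor <;> linarith

theorem mul_cpow_of_im_mul_im_nonpos {x y : ℂ} (hx : x ∈ Complex.slitPlane)
    (hy : y ∈ Complex.slitPlane) (h : x.im * y.im ≤ 0) (c : ℂ) :
    (x * y) ^ c = x ^ c * y ^ c := by
  have hx0 := Complex.slitPlane_ne_zero hx
  have hy0 := Complex.slitPlane_ne_zero hy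
  rw [Complex.cpow_def_of_ne_zero (mul_ne_zero hx0 hy0), Complex.cpow_def_of_ne_zero hx0,
    Complex.cpow_def_of_ne_zero hy0, log_mul_of_im_mul_im_nonpos hx hy h, add_mul,
    Complex.exp_add]

theorem inv_mem_slitPlane {x : ℂ} (hx : x ∈ Complex.slitPlane) : x⁻¹ ∈ Complex.slitPlane := by
  have h0 := Complex.slitPlane_ne_zero hx
  have hn : 0 < Complex.normSq x := Complex.normSq_pos.2 h0
  rw [Complex.mem_slitPlane_iff, Complex.inv_re, Complex.inv_im]
  rcases Complex.mem_slitPlane_iff.1 hx with h | h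
  · exact Or.inl (div_pos h hn)
  · exact Or.inr (div_ne_zero (neg_ne_zero.2 h) hn.ne')

theorem im_mul_inv_im_nonpos {x y : ℂ} (h : 0 ≤ x.im * y.im) : x.im * y⁻¹.im ≤ 0 := by
  rw [Complex.inv_im, ← mul_div_assoc, mul_neg]
  exact div_nonpos_of_nonpos_of_nonneg (neg_nonpos.2 h) (Complex.normSq_nonneg y)

theorem div_cpow_of_im_mul_im_nonneg {x y : ℂ} (hx : x ∈ Complex.slitPlane)
    (hy : y ∈ Complex.slitPlane) (h : 0 ≤ x.im * y.im) (c : ℂ) :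
    (x / y) ^ c = x ^ c / y ^ c := by
  rw [div_eq_mul_inv, mul_cpow_of_im_mul_im_nonpos hx (inv_mem_slitPlane hy)
    (im_mul_inv_im_nonpos h), Complex.inv_cpow _ _ (Complex.mem_slitPlane_iff_arg.1 hy).1,
    div_eq_mul_inv]

theorem rsqrt_sq {a : ℂ} (ha : a ≠ 0) :
    a ^ (-(1 / 2) : ℂ) * a ^ (-(1 / 2) : ℂ) = a⁻¹ := by
  rw [← Complex.cpow_add _ _ ha, ← Complex.cpow_neg_one]
  congr 1
  norm_num

theorem rsqrt_re_pos {a : ℂ} (ha : a ∈ Complex.slitPlane) : 0 < (a ^ (-(1 / 2) : ℂ)).re := by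
  have h0 := Complex.slitPlane_ne_zero ha
  have ha' := Complex.mem_slitPlane_iff_arg.1 ha
  have h1 := Complex.neg_pi_lt_arg a
  have h3 := lt_of_le_of_ne (Complex.arg_le_pi a) ha'.1
  rw [Complex.cpow_def_of_ne_zero h0, Complex.exp_re]
  refine mul_pos (Real.exp_pos _) (Real.cos_pos_of_mem_Ioo ?_)
  have e : (Complex.log a * (-(1 / 2) : ℂ)).im = -(a.arg / 2) := by
    rw [show (-(1 / 2) : ℂ) = ((-(1 / 2) : ℝ) : ℂ) by push_cast; ring, Complex.im_mul_ofReal,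
      Complex.log_im]
    ring
  rw [e]
  constructor <;> linarith

/-- The real part of the square of a^(-1/2) is Re(1/a) ≥ 0. -/
theorem abs_rsqrt_im_le {a : ℂ} (ha : 0 < a.re) :
    |(a ^ (-(1 / 2) : ℂ)).im| ≤ (a ^ (-(1 / 2) : ℂ)).re := by
  have hs : a ∈ Complex.slitPlane := Or.inl ha
  have h0 := Complex.slitPlane_ne_zero hs
  have h1 := congrArg Complex.re (rsqrt_sq h0)
  have h2 : 0 ≤ (a⁻¹).re := by
    rw [Complex.inv_re]
    exact div_nonneg ha.le (Complex.normSq_nonneg a)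
  rw [Complex.mul_re] at h1
  refine abs_le_of_sq_le_sq ?_ (rsqrt_re_pos hs).le
  nlinarith

theorem le_rsqrt_re {a : ℂ} {t r : ℝ} (ht : 0 < t) (ha : t ≤ a.re)
    (hn : ‖a‖ ≤ t + r) : √t / (t + r) ≤ (a ^ (-(1 / 2) : ℂ)).re := by
  have hs : a ∈ Complex.slitPlane := Or.inl (ht.trans_le ha)
  have h0 := Complex.slitPlane_ne_zero hs
  have h1 := congrArg Complex.re (rsqrt_sq h0)
  have hm : 0 < ‖a‖ := norm_pos_iff.2 h0
  have h2 : (a ^ (-(1 / 2) : ℂ)).re ^ 2 + (a ^ (-(1 / 2) : ℂ)).im ^ 2 = ‖a‖⁻¹ := by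
    have h3 := congrArg norm (rsqrt_sq h0)
    rw [norm_mul, norm_inv] at h3
    rw [← h3, ← sq, Complex.sq_norm, Complex.normSq_apply]
    ring
  rw [Complex.mul_re, Complex.inv_re, Complex.normSq_eq_norm_sq] at h1
  refine le_of_sq_le_sq ?_ (rsqrt_re_pos hs).le
  rw [div_pow, Real.sq_sqrt ht.le]
  have h4 : a.re ≤ ‖a‖ := Complex.re_le_norm a
  -- Half-angle formula, from the sum and the difference of the squares of the real and imaginary
  -- parts.
  have h5 : (a ^ (-(1 / 2) : ℂ)).re ^ 2 = (‖a‖ + a.re) / (2 * ‖a‖ ^ 2) := by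
    have : 2 * (a ^ (-(1 / 2) : ℂ)).re ^ 2 = ‖a‖⁻¹ + a.re / ‖a‖ ^ 2 := by linarith
    field_simp at this ⊢
    linarith
  rw [h5]
  calc t / (t + r) ^ 2 ≤ t / ‖a‖ ^ 2 := by gcongr
    _ = (2 * t) / (2 * ‖a‖ ^ 2) := by field_simp
    _ ≤ _ := by gcongr; linarith

/-! ### Positivity, Pfaff transformation and growth of `hyperF`. -/

theorem hyperF_weight_pos {t : ℝ} (ht : t ∈ Ioo (0 : ℝ) 1) :
    0 < (t * (1 - t)) ^ (-(1 / 2) : ℝ) :=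
  Real.rpow_pos_of_pos (mul_pos ht.1 (by linarith [ht.2])) _

theorem hyperF_integrable {z : ℂ} (hz : 1 - z ∈ Complex.slitPlane) :
    IntervalIntegrable (fun t : ℝ =>
      (((t * (1 - t)) ^ (-(1 / 2) : ℝ) : ℝ) : ℂ) * (1 - (t : ℂ) * z) ^ (-(1 / 2) : ℂ))
      volume 0 1 := by
  have h1 : IntervalIntegrable (fun t : ℝ => (((t * (1 - t)) ^ (-(1 / 2) : ℝ) : ℝ) : ℂ))
      volume 0 1 := by
    have := hyperF_weight_integrable
    rw [intervalIntegrable_iff] at this ⊢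
    exact this.ofReal
  refine h1.mul_continuousOn ?_
  rw [uIcc_of_le zero_le_one]
  exact ContinuousOn.cpow_const (by fun_prop) fun t ht => hyperF_slit ht hz

/-- The weight in Euler's integral is real and positive, so a sign of Re or of Re ± Im passes from
the factor (1-tz)^(-1/2) to `hyperF z`. -/
theorem hyperF_clm {z : ℂ} (hz : 1 - z ∈ Complex.slitPlane) (L : ℂ →L[ℝ] ℝ) :
    L (hyperF z) = (1 / Real.pi) * ∫ t in (0 : ℝ)..1,
      (t * (1 - t)) ^ (-(1 / 2) : ℝ) * L ((1 - (t : ℂ) * z) ^ (-(1 / 2) : ℂ)) := by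
  rw [hyperF_eq_integral hz, show (1 / (Real.pi : ℂ)) = ((1 / Real.pi : ℝ) : ℂ) by push_cast; rfl,
    ← Complex.real_smul, L.map_smul, smul_eq_mul,
    ← ContinuousLinearMap.intervalIntegral_comp_comm L (hyperF_integrable hz)]
  simp_rw [← Complex.real_smul, L.map_smul, smul_eq_mul]

theorem hyperF_integrable_clm {z : ℂ} (hz : 1 - z ∈ Complex.slitPlane) (L : ℂ →L[ℝ] ℝ) :
    IntervalIntegrable (fun t : ℝ =>
      (t * (1 - t)) ^ (-(1 / 2) : ℝ) * L ((1 - (t : ℂ) * z) ^ (-(1 / 2) : ℂ))) volume 0 1 := by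
  have h := hyperF_integrable hz
  rw [intervalIntegrable_iff] at h ⊢
  refine (L.integrable_comp h).congr (Filter.Eventually.of_forall fun t => ?_)
  simp only [← Complex.real_smul, L.map_smul, smul_eq_mul]

theorem hyperF_clm_nonneg {z : ℂ} (hz : 1 - z ∈ Complex.slitPlane) (L : ℂ →L[ℝ] ℝ)
    (hL : ∀ t ∈ Ioo (0 : ℝ) 1, 0 ≤ L ((1 - (t : ℂ) * z) ^ (-(1 / 2) : ℂ))) :
    0 ≤ L (hyperF z) := by
  rw [hyperF_clm hz]
  refine mul_nonneg (by positivity) ?_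
  rw [intervalIntegral.integral_of_le zero_le_one, integral_Ioc_eq_integral_Ioo]
  exact setIntegral_nonneg measurableSet_Ioo fun t ht =>
    mul_nonneg (hyperF_weight_pos ht).le (hL t ht)

theorem hyperF_re_pos {z : ℂ} (hz : 1 - z ∈ Complex.slitPlane) : 0 < (hyperF z).re := by
  have h := hyperF_clm hz Complex.reCLM
  simp only [Complex.reCLM_apply] at h
  rw [h]
  refine mul_pos (by positivity) ?_
  exact intervalIntegral.intervalIntegral_pos_of_pos_on
    (by simpa using hyperF_integrable_clm hz Complex.reCLM)
    (fun t ht => mul_pos (hyperF_weight_pos ht)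
      (rsqrt_re_pos (hyperF_slit (Ioo_subset_Icc_self ht) hz))) zero_lt_one

theorem hyperF_ne_zero {z : ℂ} (hz : 1 - z ∈ Complex.slitPlane) : hyperF z ≠ 0 := by
  intro h
  have := hyperF_re_pos hz
  simp [h] at this

theorem abs_hyperF_im_le {z : ℂ} (hz : z.re < 1) : |(hyperF z).im| ≤ (hyperF z).re := by
  have hs : 1 - z ∈ Complex.slitPlane := Or.inl (by simpa using hz)
  have hb : ∀ t ∈ Ioo (0 : ℝ) 1, |((1 - (t : ℂ) * z) ^ (-(1 / 2) : ℂ)).im| ≤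
      ((1 - (t : ℂ) * z) ^ (-(1 / 2) : ℂ)).re := fun t ht => abs_rsqrt_im_le (by
    simp
    nlinarith [ht.1, ht.2])
  have h1 := hyperF_clm_nonneg hs (Complex.reCLM - Complex.imCLM) fun t ht => by
    have := hb t ht
    simp only [sub_apply, Complex.reCLM_apply, Complex.imCLM_apply]
    linarith [(abs_le.1 this).2]
  have h2 := hyperF_clm_nonneg hs (Complex.reCLM + Complex.imCLM) fun t ht => by
    have := hb t ht
    simp only [add_apply, Complex.reCLM_apply, Complex.imCLM_apply]
    linarith [(abs_le.1 this).1]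
  simp only [add_apply, sub_apply, Complex.reCLM_apply,
    Complex.imCLM_apply] at h1 h2
  exact abs_le.2 ⟨by linarith, by linarith⟩

theorem hyperF_conj {z : ℂ} (hz : 1 - z ∈ Complex.slitPlane) :
    hyperF ((starRingEnd ℂ) z) = (starRingEnd ℂ) (hyperF z) := by
  have hz' : 1 - (starRingEnd ℂ) z ∈ Complex.slitPlane := by
    rw [Complex.mem_slitPlane_iff] at hz ⊢
    simpa using hz
  rw [hyperF_eq_integral hz, hyperF_eq_integral hz', map_mul,
    intervalIntegral.integral_of_le zero_le_one, intervalIntegral.integral_of_le zero_le_one,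
    ← integral_conj]
  congr 1
  · simp
  refine setIntegral_congr_fun measurableSet_Ioc fun t ht => ?_
  have h := Complex.conj_cpow (1 - (t : ℂ) * z) (-(1 / 2))
    (Complex.mem_slitPlane_iff_arg.1 (hyperF_slit (Ioc_subset_Icc_self ht) hz)).1
  simp only [map_mul, map_sub, map_one, Complex.conj_ofReal, map_neg, map_div₀, map_ofNat] at h ⊢
  rw [h]

/-- Substitute t ↦ 1-t in Euler's integral. The power of the quotient (1-(1-t)z)/(1-z) splits
because numerator and denominator have imaginary parts of the same sign. -/
theorem hyperF_pfaff {z : ℂ} (hz : 1 - z ∈ Complex.slitPlane) :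
    hyperF (z / (z - 1)) = (1 - z) ^ (1 / 2 : ℂ) * hyperF z := by
  have h0 := Complex.slitPlane_ne_zero hz
  have h0' : z - 1 ≠ 0 := by rwa [← neg_sub, neg_ne_zero]
  have hz' : 1 - z / (z - 1) ∈ Complex.slitPlane := by
    have : 1 - z / (z - 1) = (1 - z)⁻¹ := by field_simp; ring
    rw [this]
    exact inv_mem_slitPlane hz
  rw [hyperF_eq_integral hz, hyperF_eq_integral hz', mul_left_comm]
  congr 1
  have hsub := intervalIntegral.integral_comp_sub_left (fun t : ℝ =>
    (((t * (1 - t)) ^ (-(1 / 2) : ℝ) : ℝ) : ℂ) * (1 - (t : ℂ) * z) ^ (-(1 / 2) : ℂ)) (a := 0)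
    (b := 1) 1
  simp only [sub_self, sub_zero] at hsub
  rw [← hsub, ← intervalIntegral.integral_const_mul]
  refine intervalIntegral.integral_congr fun t ht => ?_
  rw [uIcc_of_le zero_le_one] at ht
  have ht' : 1 - t ∈ Icc (0 : ℝ) 1 := ⟨by linarith [ht.2], by linarith [ht.1]⟩
  have e : 1 - (t : ℂ) * (z / (z - 1)) = (1 - ((1 - t : ℝ) : ℂ) * z) / (1 - z) := by
    push_cast
    field_simp
    ring
  have him : 0 ≤ (1 - ((1 - t : ℝ) : ℂ) * z).im * (1 - z).im := by
    rw [Complex.sub_im, Complex.sub_im, Complex.im_ofReal_mul, Complex.one_im]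
    nlinarith [mul_nonneg ht'.1 (sq_nonneg z.im)]
  have e2 : (1 - t) * (1 - (1 - t)) = t * (1 - t) := by ring
  simp only [e, e2]
  rw [div_cpow_of_im_mul_im_nonneg (hyperF_slit ht' hz) hz him, Complex.cpow_neg (1 - z),
    div_inv_eq_mul]
  ring

/-- Logarithmic growth of `hyperF` at the branch point `1`. -/
theorem log_le_hyperF_one_sub {z : ℂ} (hz : 0 < z.re) :
    Real.log (1 / ‖z‖) ≤ Real.pi * (hyperF (1 - z)).re := by
  have hs : 1 - (1 - z) ∈ Complex.slitPlane := Or.inl (by simpa using hz)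
  have hr : 0 < ‖z‖ := norm_pos_iff.2 (by rintro rfl; simp at hz)
  have h := hyperF_clm hs Complex.reCLM
  simp only [Complex.reCLM_apply] at h
  rw [h, ← mul_assoc, mul_one_div_cancel Real.pi_ne_zero, one_mul]
  have hint := hyperF_integrable_clm hs Complex.reCLM
  simp only [Complex.reCLM_apply] at hint
  have hftc : ∫ t in (0 : ℝ)..1, 1 / (1 - t + ‖z‖) = Real.log ((1 + ‖z‖) / ‖z‖) := by
    have e := intervalIntegral.integral_comp_sub_left (fun t : ℝ => 1 / (t + ‖z‖)) (a := 0)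
      (b := 1) 1
    simp only [sub_self, sub_zero] at e
    rw [e]
    have e' := intervalIntegral.integral_comp_add_right (fun t : ℝ => 1 / t) (a := 0)
      (b := 1) ‖z‖
    rw [e', integral_one_div_of_pos (by linarith) (by linarith), zero_add]
  have hle : Real.log (1 / ‖z‖) ≤ Real.log ((1 + ‖z‖) / ‖z‖) := by
    apply Real.log_le_log (by positivity)
    gcongr
    linarith
  refine hle.trans ?_
  rw [← hftc]
  refine intervalIntegral.integral_mono_on_of_le_Ioo zero_le_one ?_ hint fun t ht => ?_
  · refine ContinuousOn.intervalIntegrable ?_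
    rw [uIcc_of_le zero_le_one]
    exact continuousOn_const.div (by fun_prop) fun t ht => by linarith [ht.2]
  · have ht1 : 0 < 1 - t := by linarith [ht.2]
    -- Since 1 - t(1-z) = (1-t) + tz, its real part is at least 1-t and its modulus at most 1-t+‖z‖.
    -- The factor √(1-t) then cancels the singularity of the weight at t = 1.
    have h1 : √(1 - t) / (1 - t + ‖z‖) ≤ ((1 - (t : ℂ) * (1 - z)) ^ (-(1 / 2) : ℂ)).re := by
      refine le_rsqrt_re ht1 ?_ ?_
      · simp
        nlinarith [ht.1]
      · have e : 1 - (t : ℂ) * (1 - z) = ((1 - t : ℝ) : ℂ) + t * z := by push_cast; ring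
        rw [e]
        refine (norm_add_le _ _).trans ?_
        rw [norm_mul, Complex.norm_real, Complex.norm_real, Real.norm_of_nonneg ht1.le,
          Real.norm_of_nonneg ht.1.le]
        gcongr
        exact mul_le_of_le_one_left hr.le ht.2.le
    calc 1 / (1 - t + ‖z‖) ≤ (t * (1 - t)) ^ (-(1 / 2) : ℝ) * (√(1 - t) / (1 - t + ‖z‖)) := by
          rw [← mul_div_assoc]
          gcongr
          rw [Real.mul_rpow ht.1.le ht1.le, Real.rpow_neg ht1.le, ← Real.sqrt_eq_rpow, mul_assoc,
            inv_mul_cancel₀ (Real.sqrt_pos.2 ht1).ne', mul_one]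
          exact Real.one_le_rpow_of_pos_of_le_one_of_nonpos ht.1 ht.2.le (by norm_num)
      _ ≤ _ := by
          have := (hyperF_weight_pos ht).le
          gcongr

/-! ### The elliptic integral and the connection formula. -/

/-- The differential of the elliptic integral with branch points `0`, `1`, `1 / u`, `∞`. -/
def ellipticIntegrand (u x : ℂ) : ℂ :=
  x ^ (-(1 / 2) : ℂ) * (1 - x) ^ (-(1 / 2) : ℂ) * (1 - u * x) ^ (-(1 / 2) : ℂ)

/-- The incomplete elliptic integral `∫₀ˣ`, uniformized at `0` by the square root. -/
def ellipticIntegral (u x : ℂ) : ℂ :=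
  segmentPrimitive (fun y => 2 * (1 - y ^ 2) ^ (-(1 / 2) : ℂ) * (1 - u * y ^ 2) ^ (-(1 / 2) : ℂ))
    0 (x ^ (1 / 2 : ℂ))

/-- The domain on which `ellipticIntegral` is a primitive of `ellipticIntegrand`. -/
def ellipticDomain (u : ℂ) : Set ℂ :=
  {x | x ∈ Complex.slitPlane ∧ 1 - x ∈ Complex.slitPlane ∧ 1 - u * x ∈ Complex.slitPlane}

/-- After x = y² the differential is regular at the vertex 0 and its domain is star-shaped about 0,
so 0 can serve as the base point. -/
theorem hasDerivAt_ellipticPrimitive (u : ℂ) {y : ℂ} (h1 : 1 - y ^ 2 ∈ Complex.slitPlane)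
    (h2 : 1 - u * y ^ 2 ∈ Complex.slitPlane) :
    HasDerivAt (segmentPrimitive
      (fun y => 2 * (1 - y ^ 2) ^ (-(1 / 2) : ℂ) * (1 - u * y ^ 2) ^ (-(1 / 2) : ℂ)) 0)
      (2 * (1 - y ^ 2) ^ (-(1 / 2) : ℂ) * (1 - u * y ^ 2) ^ (-(1 / 2) : ℂ)) y := by
  refine hasDerivAt_segmentPrimitive
    (U := {y : ℂ | 1 - y ^ 2 ∈ Complex.slitPlane ∧ 1 - u * y ^ 2 ∈ Complex.slitPlane})
    ((Complex.isOpen_slitPlane.preimage (by fun_prop)).inter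
      (Complex.isOpen_slitPlane.preimage (by fun_prop))) ?_ ?_ ⟨h1, h2⟩
  · rw [starConvex_zero_iff]
    rintro y ⟨hy1, hy2⟩ a ha0 ha1
    have ha : a ^ 2 ∈ Icc (0 : ℝ) 1 := ⟨by positivity, pow_le_one₀ ha0 ha1⟩
    have e1 := hyperF_slit ha hy1
    have e2 := hyperF_slit ha hy2
    constructor
    · convert e1 using 1
      rw [Complex.real_smul]; push_cast; ring
    · convert e2 using 1
      rw [Complex.real_smul]; push_cast; ring
  · rintro y ⟨hy1, hy2⟩
    refine DifferentiableAt.differentiableWithinAt ?_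
    exact (((by fun_prop : DifferentiableAt ℂ (fun y : ℂ => 1 - y ^ 2) y).cpow_const
      hy1).const_mul 2).mul
      ((by fun_prop : DifferentiableAt ℂ (fun y : ℂ => 1 - u * y ^ 2) y).cpow_const hy2)

theorem hasDerivAt_ellipticIntegral {u x : ℂ} (hx : x ∈ ellipticDomain u) :
    HasDerivAt (ellipticIntegral u) (ellipticIntegrand u x) x := by
  obtain ⟨h0, h1, h2⟩ := hx
  have e : (x ^ (1 / 2 : ℂ)) ^ 2 = x := by
    rw [← Complex.cpow_nat_mul]; simp
  have hd := hasDerivAt_ellipticPrimitive u (y := x ^ (1 / 2 : ℂ)) (by rwa [e]) (by rwa [e])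
  have hs := (hasDerivAt_id x).cpow_const (c := (1 / 2 : ℂ)) h0
  refine (hd.comp x hs).congr_deriv ?_
  have e3 : (1 / 2 - 1 : ℂ) = -(1 / 2) := by norm_num
  rw [e, id, e3, ellipticIntegrand]
  ring

theorem tendsto_ellipticIntegral_zero (u v : ℂ) :
    Filter.Tendsto (fun t : ℝ => ellipticIntegral u (t * v)) (nhdsWithin 0 (Ioi 0)) (nhds 0) := by
  have h1 : Filter.Tendsto (fun t : ℝ => ((t : ℂ) * v) ^ (1 / 2 : ℂ)) (nhds 0) (nhds 0) := by
    have h2 : ContinuousAt (fun x : ℂ => x ^ (1 / 2 : ℂ)) 0 :=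
      Complex.continuousAt_cpow_const_of_re_pos (Or.inl le_rfl) (by norm_num)
    have h3 : Filter.Tendsto (fun t : ℝ => (t : ℂ) * v) (nhds 0) (nhds 0) := by
      have : Continuous fun t : ℝ => (t : ℂ) * v := by fun_prop
      simpa using this.tendsto 0
    have h4 := h2.tendsto.comp h3
    simpa [Function.comp_def] using h4
  have hd := (hasDerivAt_ellipticPrimitive u (y := 0) (by simp) (by simp)).continuousAt.tendsto
  rw [segmentPrimitive_self] at hd
  exact (hd.comp h1).mono_left nhdsWithin_le_nhds

theorem ofReal_mul_cpow {r : ℝ} (hr : 0 < r) {x : ℂ} (hx : x ∈ Complex.slitPlane) (c : ℂ) :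
    ((r : ℂ) * x) ^ c = (r : ℂ) ^ c * x ^ c :=
  mul_cpow_of_im_mul_im_nonpos (Or.inl (by simpa using hr)) hx (by simp) c

theorem hyperF_weight_eq {t : ℝ} (ht : t ∈ Ioo (0 : ℝ) 1) :
    (((t * (1 - t)) ^ (-(1 / 2) : ℝ) : ℝ) : ℂ) =
      (t : ℂ) ^ (-(1 / 2) : ℂ) * ((1 - t : ℝ) : ℂ) ^ (-(1 / 2) : ℂ) := by
  have h1 : (0 : ℝ) < 1 - t := by linarith [ht.2]
  rw [Real.mul_rpow ht.1.le h1.le, Complex.ofReal_mul, Complex.ofReal_cpow ht.1.le,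
    Complex.ofReal_cpow h1.le]
  push_cast
  rfl

theorem pi_mul_hyperF {z : ℂ} (hz : 1 - z ∈ Complex.slitPlane) :
    Real.pi * hyperF z = ∫ t in (0 : ℝ)..1,
      (((t * (1 - t)) ^ (-(1 / 2) : ℝ) : ℝ) : ℂ) * (1 - (t : ℂ) * z) ^ (-(1 / 2) : ℂ) := by
  have hpi : (Real.pi : ℂ) ≠ 0 := by exact_mod_cast Real.pi_ne_zero
  rw [hyperF_eq_integral hz, ← mul_assoc, mul_one_div_cancel hpi, one_mul]

theorem one_sub_mem_slitPlane {u : ℂ} (hu : u.im ≠ 0) : 1 - u ∈ Complex.slitPlane :=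
  Or.inr (by simpa using hu)

theorem inv_im_pos {u : ℂ} (hu : u.im < 0) : 0 < u⁻¹.im := by
  have hn : 0 < Complex.normSq u := Complex.normSq_pos.2 (by rintro rfl; simp at hu)
  rw [Complex.inv_im]
  exact div_pos (neg_pos.2 hu) hn

/-- The side from 0 to 1 of the triangle: here the differential is Euler's integrand for `hyperF u`.
-/
theorem ellipticIntegral_tendsto_one {u : ℂ} (hu : u.im < 0) :
    Filter.Tendsto (fun t : ℝ => ellipticIntegral u t) (nhdsWithin 1 (Iio 1))
      (nhds (Real.pi * hyperF u)) := by
  have hs := one_sub_mem_slitPlane hu.ne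
  have h := tendsto_of_hasDerivAt_of_integrable (K := fun t : ℝ => ellipticIntegral u t) zero_lt_one
    (fun t ht => ?_) (hyperF_integrable hs) (by simpa using tendsto_ellipticIntegral_zero u 1)
  · rwa [zero_add, ← pi_mul_hyperF hs] at h
  · have hW : (t : ℂ) ∈ ellipticDomain u := by
      refine ⟨Or.inl (by simpa using ht.1), Or.inl (by simpa using ht.2), ?_⟩
      rw [mul_comm]
      exact hyperF_slit (Ioo_subset_Icc_self ht) hs
    refine (hasDerivAt_ellipticIntegral hW).comp_ofReal.congr_deriv ?_
    rw [ellipticIntegrand, hyperF_weight_eq ht, mul_comm u]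
    push_cast
    rfl

/-- On the side x = t/u the factors 1-x and 1-ux exchange roles, which gives `hyperF u⁻¹`; the
factor u^(-1/2) comes from x^(-1/2) dx. -/
theorem ellipticIntegral_tendsto_inv {u : ℂ} (hu : u.im < 0) :
    Filter.Tendsto (fun t : ℝ => ellipticIntegral u (t * u⁻¹)) (nhdsWithin 1 (Iio 1))
      (nhds (u ^ (-(1 / 2) : ℂ) * (Real.pi * hyperF u⁻¹))) := by
  have hu' := inv_im_pos hu
  have hu0 : u ≠ 0 := by rintro rfl; simp at hu
  have hsu : u ∈ Complex.slitPlane := Or.inr hu.ne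
  have hs := one_sub_mem_slitPlane hu'.ne'
  have h := tendsto_of_hasDerivAt_of_integrable
    (K := fun t : ℝ => ellipticIntegral u (t * u⁻¹)) zero_lt_one
    (fun t ht => ?_) ((hyperF_integrable hs).const_mul (u ^ (-(1 / 2) : ℂ)))
    (tendsto_ellipticIntegral_zero u u⁻¹)
  · rwa [zero_add, intervalIntegral.integral_const_mul, ← pi_mul_hyperF hs] at h
  · have e : 1 - u * ((t : ℂ) * u⁻¹) = ((1 - t : ℝ) : ℂ) := by
      push_cast
      field_simp
    have hW : (t : ℂ) * u⁻¹ ∈ ellipticDomain u := by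
      refine ⟨Or.inr ?_, hyperF_slit (Ioo_subset_Icc_self ht) hs, ?_⟩
      · rw [Complex.im_ofReal_mul]
        exact (mul_pos ht.1 hu').ne'
      · rw [e]
        exact Or.inl (by simpa using ht.2)
    have hl : HasDerivAt (fun t : ℝ => (t : ℂ) * u⁻¹) u⁻¹ t := by
      simpa using (Complex.ofRealCLM.hasDerivAt (x := t)).mul_const u⁻¹
    refine ((hasDerivAt_ellipticIntegral hW).comp t hl).congr_deriv ?_
    rw [ellipticIntegrand, hyperF_weight_eq ht, e, ofReal_mul_cpow ht.1 (inv_mem_slitPlane hsu),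
      Complex.inv_cpow _ _ (Complex.mem_slitPlane_iff_arg.1 hsu).1, ← rsqrt_sq hu0]
    have h0 : u ^ (-(1 / 2) : ℂ) ≠ 0 := by simp [Complex.cpow_eq_zero_iff, hu0]
    field_simp

theorem norm_rsqrt {a : ℂ} (ha : a ≠ 0) : ‖a ^ (-(1 / 2) : ℂ)‖ = ‖a‖ ^ (-(1 / 2) : ℝ) := by
  have h := Complex.norm_cpow_of_ne_zero ha (-(1 / 2) : ℂ)
  rw [h]
  have e : (-(1 / 2) : ℂ) = ((-(1 / 2) : ℝ) : ℂ) := by push_cast; ring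
  rw [e, Complex.ofReal_re, Complex.ofReal_im]
  simp

/-- Near a vertex e the integrand is O(ε^(-1/2)) on a segment of length O(ε) that cuts the corner.
The increment is O(√ε), so the limits along the two sides at e agree. -/
theorem ellipticIntegral_corner {u e d₁ d₂ : ℂ} {c : ℝ} (hc : 0 < c)
    (h : ∀ᶠ ε : ℝ in nhdsWithin 0 (Ioi 0), ∀ a ∈ Icc (0 : ℝ) 1, ∀ z : ℂ,
      z = e + ε * ((1 - a) * d₁ + a * d₂) →
        z ∈ ellipticDomain u ∧ c * ε ≤ ‖z‖ * ‖1 - z‖ * ‖1 - u * z‖) :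
    Filter.Tendsto (fun ε : ℝ => ellipticIntegral u (e + ε * d₂) - ellipticIntegral u (e + ε * d₁))
      (nhdsWithin 0 (Ioi 0)) (nhds 0) := by
  have hlim : Filter.Tendsto (fun ε : ℝ => c ^ (-(1 / 2) : ℝ) * ‖d₂ - d₁‖ * ε ^ (1 / 2 : ℝ))
      (nhdsWithin 0 (Ioi 0)) (nhds 0) := by
    have : ContinuousAt (fun ε : ℝ => c ^ (-(1 / 2) : ℝ) * ‖d₂ - d₁‖ * ε ^ (1 / 2 : ℝ)) 0 :=
      continuousAt_const.mul (Real.continuousAt_rpow_const _ _ (Or.inr (by norm_num)))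
    have h2 := this.tendsto.mono_left (nhdsWithin_le_nhds (s := Ioi 0))
    rwa [Real.zero_rpow (by norm_num), mul_zero] at h2
  refine squeeze_zero_norm' ?_ hlim
  filter_upwards [h, self_mem_nhdsWithin] with ε hε (hpos : 0 < ε)
  have hseg : ∀ z ∈ segment ℝ (e + ε * d₁) (e + ε * d₂),
      z ∈ ellipticDomain u ∧ c * ε ≤ ‖z‖ * ‖1 - z‖ * ‖1 - u * z‖ := by
    intro z hz
    rw [segment_eq_image] at hz
    obtain ⟨a, ha, rfl⟩ := hz
    refine hε a ha _ ?_
    simp only [Complex.real_smul]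
    push_cast
    ring
  have hm := norm_sub_le_of_segment (C := (c * ε) ^ (-(1 / 2) : ℝ))
    (fun z hz => hasDerivAt_ellipticIntegral (hseg z hz).1) fun z hz => by
      obtain ⟨⟨h0, h1, h2⟩, hb⟩ := hseg z hz
      rw [ellipticIntegrand, norm_mul, norm_mul, norm_rsqrt (Complex.slitPlane_ne_zero h0),
        norm_rsqrt (Complex.slitPlane_ne_zero h1), norm_rsqrt (Complex.slitPlane_ne_zero h2),
        ← Real.mul_rpow (norm_nonneg _) (norm_nonneg _),
        ← Real.mul_rpow (by positivity) (norm_nonneg _)]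
      exact Real.rpow_le_rpow_of_nonpos (by positivity) hb (by norm_num)
  refine hm.trans (le_of_eq ?_)
  have e1 : e + ε * d₂ - (e + ε * d₁) = ε * (d₂ - d₁) := by ring
  have e2 : ε ^ (1 / 2 : ℝ) = ε ^ (-(1 / 2) : ℝ) * ε := by
    rw [← Real.rpow_add_one hpos.ne']
    norm_num
  rw [e1, norm_mul, Complex.norm_real, Real.norm_of_nonneg hpos.le, Real.mul_rpow hc.le hpos.le, e2]
  ring

/-- A lower bound for the distance from 0 to the segment [1, v]. The imaginary parts of the point w
and of w times the conjugate of v are a Im v and -(1-a) Im v; add the two resulting bounds. -/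
theorem norm_convex_one_ge (v : ℂ) {a : ℝ} (ha : a ∈ Icc (0 : ℝ) 1) :
    |v.im| / (1 + ‖v‖) ≤ ‖(1 - a) + a * v‖ := by
  rw [div_le_iff₀ (by positivity)]
  have h1 : a * |v.im| ≤ ‖(1 - a) + a * v‖ := by
    have := Complex.abs_im_le_norm ((1 - a : ℂ) + a * v)
    simpa [abs_mul, abs_of_nonneg ha.1] using this
  have h2 : (1 - a) * |v.im| ≤ ‖(1 - a) + a * v‖ * ‖v‖ := by
    have := Complex.abs_im_le_norm (((1 - a : ℂ) + a * v) * (starRingEnd ℂ) v)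
    rw [norm_mul, Complex.norm_conj] at this
    refine le_trans (le_of_eq ?_) this
    rw [← abs_of_nonneg (by linarith [ha.2] : 0 ≤ 1 - a), ← abs_mul, ← abs_neg]
    congr 1
    simp [Complex.mul_im]
    ring
  linarith

theorem ellipticIntegral_corner_one {u : ℂ} (hu : u.im < 0) :
    Filter.Tendsto (fun ε : ℝ => ellipticIntegral u (1 + ε * -(1 - u⁻¹)) -
      ellipticIntegral u (1 + ε * -1)) (nhdsWithin 0 (Ioi 0)) (nhds 0) := by
  have hu0 : u ≠ 0 := by rintro rfl; simp at hu
  have hu' := inv_im_pos hu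
  set v : ℂ := 1 - u⁻¹ with hv
  have hvi : v.im = -u⁻¹.im := by simp [hv]
  set μ : ℝ := |v.im| / (1 + ‖v‖) with hμ
  have hμ0 : 0 < μ := div_pos (abs_pos.2 (by rw [hvi]; linarith)) (by positivity)
  have hui : 0 < -u.im := by linarith
  refine ellipticIntegral_corner (c := 1 / 2 * μ * (-u.im / 2)) (by positivity) ?_
  have hsmall : (0 : ℝ) < 1 / (2 * (1 + ‖v‖)) := by positivity
  filter_upwards [Ioo_mem_nhdsGT hsmall] with ε hε a ha z hz
  have hz' : z = 1 - ε * ((1 - a) + a * v) := by rw [hz]; ring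
  have hm : ‖(1 - a : ℂ) + a * v‖ ≤ 1 + ‖v‖ := by
    refine (norm_add_le _ _).trans ?_
    rw [norm_mul, Complex.norm_real, Real.norm_of_nonneg ha.1,
      show (1 - a : ℂ) = ((1 - a : ℝ) : ℂ) by push_cast; rfl, Complex.norm_real,
      Real.norm_of_nonneg (by linarith [ha.2])]
    have := mul_le_of_le_one_left (norm_nonneg v) ha.2
    linarith [ha.1]
  have hε2 : ε * (1 + ‖v‖) < 1 / 2 := by
    have := hε.2
    rw [lt_div_iff₀ (by positivity)] at this
    linarith
  have hεh : ε < 1 / 2 := by nlinarith [norm_nonneg v, hε.1]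
  have h1z : 1 - z = ε * ((1 - a) + a * v) := by rw [hz']; ring
  have h1zn : ‖1 - z‖ = ε * ‖(1 - a : ℂ) + a * v‖ := by
    rw [h1z, norm_mul, Complex.norm_real, Real.norm_of_nonneg hε.1.le]
  have hre : 1 / 2 ≤ z.re := by
    have h3 : (1 - z).re ≤ 1 / 2 := (Complex.re_le_norm _).trans (by
      rw [h1zn]
      exact (mul_le_mul_of_nonneg_left hm hε.1.le).trans hε2.le)
    simp at h3
    linarith
  have hze : 1 - u * z = (1 - u) + ε * (u - a) := by
    rw [hz', hv]
    field_simp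
    ring
  have him : (1 - u * z).im = (1 - ε) * -u.im := by
    rw [hze]
    simp
    ring
  refine ⟨⟨Or.inl (by linarith), ?_, Or.inr ?_⟩, ?_⟩
  · rw [h1z, Complex.mem_slitPlane_iff, Complex.im_ofReal_mul, Complex.re_ofReal_mul]
    have e1 : ((1 - a : ℂ) + a * v).im = a * v.im := by simp
    have e2 : ((1 - a : ℂ) + a * v).re = (1 - a) + a * v.re := by simp
    rcases ha.1.lt_or_eq with h | h
    · right
      rw [e1, hvi]
      have := mul_pos hε.1 (mul_pos h hu')
      linarith
    · left
      rw [e2, ← h]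
      simpa using hε.1
  · rw [him]
    exact (mul_pos (by linarith) hui).ne'
  · have b1 : 1 / 2 ≤ ‖z‖ := hre.trans (Complex.re_le_norm z)
    have b2 : ε * μ ≤ ‖1 - z‖ := by
      rw [h1zn]
      exact mul_le_mul_of_nonneg_left (norm_convex_one_ge v ha) hε.1.le
    have b3 : -u.im / 2 ≤ ‖1 - u * z‖ := by
      refine le_trans ?_ (Complex.im_le_norm _)
      rw [him]
      nlinarith
    have hε0 := hε.1
    calc 1 / 2 * μ * (-u.im / 2) * ε = 1 / 2 * (ε * μ) * (-u.im / 2) := by ring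
      _ ≤ _ := by gcongr

theorem ellipticIntegral_corner_inv {u : ℂ} (hu : u.im < 0) :
    Filter.Tendsto (fun ε : ℝ => ellipticIntegral u (u⁻¹ + ε * (1 - u⁻¹)) -
      ellipticIntegral u (u⁻¹ + ε * -u⁻¹)) (nhdsWithin 0 (Ioi 0)) (nhds 0) := by
  have hu0 : u ≠ 0 := by rintro rfl; simp at hu
  have hu' := inv_im_pos hu
  set v : ℂ := 1 - u with hv
  have hvi : v.im = -u.im := by simp [hv]
  set μ : ℝ := |v.im| / (1 + ‖v‖) with hμ
  have hμ0 : 0 < μ := div_pos (abs_pos.2 (by rw [hvi]; linarith)) (by positivity)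
  refine ellipticIntegral_corner (c := u⁻¹.im / 2 * (u⁻¹.im / 2) * μ) (by positivity) ?_
  filter_upwards [Ioo_mem_nhdsGT (by norm_num : (0 : ℝ) < 1 / 2)] with ε hε a ha z hz
  have hz' : z = (1 - ε) * u⁻¹ + ε * a := by rw [hz]; ring
  have h1z : 1 - u * z = ε * ((1 - a) + a * v) := by
    rw [hz', hv]
    field_simp
    ring
  have him : z.im = (1 - ε) * u⁻¹.im := by
    rw [hz']
    simp
  have himp : u⁻¹.im / 2 ≤ z.im := by
    rw [him]
    nlinarith [hε.2]
  have him1 : (1 - z).im = -z.im := by simp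
  refine ⟨⟨Or.inr (by linarith), Or.inr (by rw [him1]; linarith), ?_⟩, ?_⟩
  · rw [h1z, Complex.mem_slitPlane_iff, Complex.im_ofReal_mul, Complex.re_ofReal_mul]
    have e1 : ((1 - a : ℂ) + a * v).im = a * v.im := by simp
    have e2 : ((1 - a : ℂ) + a * v).re = (1 - a) + a * v.re := by simp
    rcases ha.1.lt_or_eq with h | h
    · right
      rw [e1, hvi]
      exact (mul_pos hε.1 (mul_pos h (by linarith))).ne'
    · left
      rw [e2, ← h]
      simpa using hε.1
  · have b1 : u⁻¹.im / 2 ≤ ‖z‖ := himp.trans (Complex.im_le_norm z)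
    have b2 : u⁻¹.im / 2 ≤ ‖1 - z‖ := by
      refine le_trans ?_ (Complex.abs_im_le_norm _)
      rw [him1, abs_neg]
      exact himp.trans (le_abs_self _)
    have b3 : ε * μ ≤ ‖1 - u * z‖ := by
      rw [h1z, norm_mul, Complex.norm_real, Real.norm_of_nonneg hε.1.le]
      exact mul_le_mul_of_nonneg_left (norm_convex_one_ge v ha) hε.1.le
    have hε0 := hε.1
    calc u⁻¹.im / 2 * (u⁻¹.im / 2) * μ * ε = u⁻¹.im / 2 * (u⁻¹.im / 2) * (ε * μ) := by ring
      _ ≤ _ := by gcongr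

/-- The source of the factor i in the connection formula: for Im u < 0 the principal logarithms of
1-u and u-1 differ by πi. -/
theorem one_sub_rsqrt {u : ℂ} (hu : u.im < 0) :
    (1 - u) ^ (-(1 / 2) : ℂ) = -Complex.I * (u - 1) ^ (-(1 / 2) : ℂ) := by
  have hi : (u - 1).im < 0 := by simpa using hu
  have h0 : u - 1 ≠ 0 := by intro h; simp [h] at hi
  have h0' : 1 - u ≠ 0 := by rwa [← neg_sub, neg_ne_zero]
  have hl : Complex.log (1 - u) = Complex.log (u - 1) + Real.pi * Complex.I := by
    rw [← neg_sub, Complex.log, Complex.log, norm_neg,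
      Complex.arg_neg_eq_arg_add_pi_of_im_neg hi]
    push_cast
    ring
  rw [Complex.cpow_def_of_ne_zero h0, Complex.cpow_def_of_ne_zero h0', hl, add_mul,
    Complex.exp_add, mul_comm]
  congr 1
  rw [show (Real.pi : ℂ) * Complex.I * (-(1 / 2)) = -(Real.pi / 2 * Complex.I) by ring,
    Complex.exp_neg, Complex.exp_pi_div_two_mul_I, Complex.inv_I]

/-- The integrand along the side of the triangle that joins `1 / u` to `1`. -/
theorem ellipticIntegrand_side {u : ℂ} (hu : u.im < 0) {t : ℝ} (ht : t ∈ Ioo (0 : ℝ) 1) :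
    u⁻¹ + t * (1 - u⁻¹) ∈ ellipticDomain u ∧
    ellipticIntegrand u (u⁻¹ + t * (1 - u⁻¹)) * (1 - u⁻¹) =
      -Complex.I * ((((t * (1 - t)) ^ (-(1 / 2) : ℝ) : ℝ) : ℂ) *
        (1 - (t : ℂ) * (1 - u)) ^ (-(1 / 2) : ℂ)) := by
  have hu0 : u ≠ 0 := by rintro rfl; simp at hu
  have hsu : u ∈ Complex.slitPlane := Or.inr hu.ne
  have hi : (u - 1).im < 0 := by simpa using hu
  have h0 : u - 1 ≠ 0 := by intro h; simp [h] at hi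
  have hs1 : u - 1 ∈ Complex.slitPlane := Or.inr hi.ne
  have hs2 : 1 - u ∈ Complex.slitPlane := one_sub_mem_slitPlane hu.ne
  have hs3 : 1 - (1 - u) ∈ Complex.slitPlane := by rwa [sub_sub_cancel]
  have ht1 : 0 < 1 - t := by linarith [ht.2]
  have e1 : u⁻¹ + t * (1 - u⁻¹) = (1 - t * (1 - u)) / u := by field_simp; ring
  have e2 : 1 - (u⁻¹ + t * (1 - u⁻¹)) = ((1 - t : ℝ) : ℂ) * ((u - 1) / u) := by
    push_cast; field_simp; ring
  have e3 : 1 - u * (u⁻¹ + t * (1 - u⁻¹)) = (t : ℂ) * (1 - u) := by field_simp; ring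
  have hs4 := hyperF_slit (Ioo_subset_Icc_self ht) hs3
  have him4 : (1 - (t : ℂ) * (1 - u)).im = t * u.im := by simp
  have hv : ((u - 1) / u).im < 0 := by
    have e : (u - 1) / u = 1 - u⁻¹ := by field_simp
    rw [e]
    simpa using inv_im_pos hu
  constructor
  · refine ⟨Or.inr ?_, ?_, ?_⟩
    · have : (u⁻¹ + t * (1 - u⁻¹)).im = (1 - t) * u⁻¹.im := by
        simp
        ring
      rw [this]
      exact (mul_pos ht1 (inv_im_pos hu)).ne'
    · rw [e2]
      refine Or.inr ?_
      rw [Complex.im_ofReal_mul]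
      exact (mul_neg_of_pos_of_neg ht1 hv).ne
    · rw [e3]
      refine Or.inr ?_
      rw [Complex.im_ofReal_mul]
      exact mul_ne_zero ht.1.ne' (by simpa using hu.ne)
  · rw [ellipticIntegrand, e2, e3, e1,
      div_cpow_of_im_mul_im_nonneg hs4 hsu (by rw [him4]; nlinarith [ht.1, sq_nonneg u.im]),
      ofReal_mul_cpow ht1 (Or.inr hv.ne), ofReal_mul_cpow ht.1 hs2,
      div_cpow_of_im_mul_im_nonneg hs1 hsu (by nlinarith), one_sub_rsqrt hu, hyperF_weight_eq ht]
    have n0 : u ^ (-(1 / 2) : ℂ) ≠ 0 := by simp [Complex.cpow_eq_zero_iff, hu0]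
    have r1 := rsqrt_sq hu0
    have r2 := rsqrt_sq h0
    have e4 : (1 - u⁻¹) = (u - 1) * (u ^ (-(1 / 2) : ℂ) * u ^ (-(1 / 2) : ℂ)) := by
      rw [r1]; field_simp
    rw [e4]
    have r3 : (u - 1) ^ (-(1 / 2) : ℂ) * (u - 1) ^ (-(1 / 2) : ℂ) * (u - 1) = 1 := by
      rw [r2, inv_mul_cancel₀ h0]
    generalize (u - 1) ^ (-(1 / 2) : ℂ) = p at *
    generalize u ^ (-(1 / 2) : ℂ) = q at *
    field_simp
    linear_combination (-(t : ℂ) ^ (-(1 / 2) : ℂ) *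
      ((1 - t : ℝ) : ℂ) ^ (-(1 / 2) : ℂ) * (1 - (t : ℂ) * (1 - u)) ^ (-(1 / 2) : ℂ)) * r3

/-- Connection formula for `hyperF` between `∞` and the finite branch points. -/
theorem hyperF_inv {u : ℂ} (hu : u.im < 0) :
    u ^ (-(1 / 2) : ℂ) * hyperF u⁻¹ = hyperF u + Complex.I * hyperF (1 - u) := by
  have hs3 : 1 - (1 - u) ∈ Complex.slitPlane := by
    rw [sub_sub_cancel]; exact Or.inr hu.ne
  have hpi : (Real.pi : ℂ) ≠ 0 := by exact_mod_cast Real.pi_ne_zero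
  have hrev : Filter.Tendsto (fun ε : ℝ => 1 - ε) (nhdsWithin 0 (Ioi 0))
      (nhdsWithin 1 (Iio 1)) := by
    refine tendsto_nhdsWithin_iff.2 ⟨?_, ?_⟩
    · have : Continuous fun ε : ℝ => 1 - ε := by fun_prop
      simpa using (this.tendsto 0).mono_left (nhdsWithin_le_nhds (s := Ioi 0))
    · filter_upwards [self_mem_nhdsWithin] with ε (hε : 0 < ε)
      simpa using hε
  have hrev' : Filter.Tendsto (fun ε : ℝ => 1 - ε) (nhdsWithin 1 (Iio 1))
      (nhdsWithin 0 (Ioi 0)) := by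
    refine tendsto_nhdsWithin_iff.2 ⟨?_, ?_⟩
    · have : Continuous fun ε : ℝ => 1 - ε := by fun_prop
      simpa using (this.tendsto 1).mono_left (nhdsWithin_le_nhds (s := Iio 1))
    · filter_upwards [self_mem_nhdsWithin] with ε (hε : ε < 1)
      simpa using hε
  -- The limit at 1/u is known along the side from 0; the corner estimate carries it over to the
  -- side from 1/u to 1. The vertex 1 is treated likewise.
  have l0 : Filter.Tendsto (fun t : ℝ => ellipticIntegral u (u⁻¹ + t * (1 - u⁻¹)))
      (nhdsWithin 0 (Ioi 0)) (nhds (u ^ (-(1 / 2) : ℂ) * (Real.pi * hyperF u⁻¹))) := by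
    have h1 := (ellipticIntegral_corner_inv hu).add ((ellipticIntegral_tendsto_inv hu).comp hrev)
    rw [zero_add] at h1
    refine h1.congr fun ε => ?_
    have e : u⁻¹ + (ε : ℂ) * -u⁻¹ = ((1 - ε : ℝ) : ℂ) * u⁻¹ := by push_cast; ring
    rw [e, Function.comp_apply]
    ring
  have l1 : Filter.Tendsto (fun t : ℝ => ellipticIntegral u (u⁻¹ + t * (1 - u⁻¹)))
      (nhdsWithin 1 (Iio 1)) (nhds (Real.pi * hyperF u)) := by
    have h1 := ((ellipticIntegral_corner_one hu).add
      ((ellipticIntegral_tendsto_one hu).comp hrev)).comp hrev'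
    rw [zero_add] at h1
    refine h1.congr fun t => ?_
    have e : (1 : ℂ) + ((1 - t : ℝ) : ℂ) * -1 = ((1 - (1 - t) : ℝ) : ℂ) := by push_cast; ring
    have e2 : (1 : ℂ) + ((1 - t : ℝ) : ℂ) * -(1 - u⁻¹) = u⁻¹ + t * (1 - u⁻¹) := by
      push_cast; ring
    rw [Function.comp_apply, Function.comp_apply, e, e2]
    ring
  have hint := intervalIntegral.integral_eq_sub_of_hasDerivAt_of_tendsto
    (f := fun t : ℝ => ellipticIntegral u (u⁻¹ + t * (1 - u⁻¹))) zero_lt_one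
    (fun t ht => by
      have hl : HasDerivAt (fun t : ℝ => u⁻¹ + (t : ℂ) * (1 - u⁻¹)) (1 - u⁻¹) t := by
        simpa using ((Complex.ofRealCLM.hasDerivAt (x := t)).mul_const (1 - u⁻¹)).const_add u⁻¹
      have hside := ellipticIntegrand_side hu ht
      exact ((hasDerivAt_ellipticIntegral hside.1).comp t hl).congr_deriv hside.2)
    ((hyperF_integrable hs3).const_mul (-Complex.I)) l0 l1
  rw [intervalIntegral.integral_const_mul, ← pi_mul_hyperF hs3] at hint
  have : (Real.pi : ℂ) * (u ^ (-(1 / 2) : ℂ) * hyperF u⁻¹) =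
      Real.pi * (hyperF u + Complex.I * hyperF (1 - u)) := by linear_combination hint
  exact mul_left_cancel₀ hpi this

/-! ### The doubly slit plane and the transformation z ↦ z/(z-1). -/

/-- The doubly slit plane `ℂ ∖ ((-∞, 0] ∪ [1, ∞))`. -/
def doublySlitPlane : Set ℂ := {z | z ∈ Complex.slitPlane ∧ 1 - z ∈ Complex.slitPlane}

theorem isOpen_doublySlitPlane : IsOpen doublySlitPlane :=
  Complex.isOpen_slitPlane.inter (Complex.isOpen_slitPlane.preimage (by fun_prop))

theorem one_sub_mem_doublySlitPlane {z : ℂ} (hz : z ∈ doublySlitPlane) :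
    1 - z ∈ doublySlitPlane := ⟨hz.2, by rw [sub_sub_cancel]; exact hz.1⟩

theorem mem_doublySlitPlane_of_im {z : ℂ} (hz : z.im ≠ 0) : z ∈ doublySlitPlane :=
  ⟨Or.inr hz, one_sub_mem_slitPlane hz⟩

theorem mem_doublySlitPlane_of_re {z : ℂ} (h0 : 0 < z.re) (h1 : z.re < 1) :
    z ∈ doublySlitPlane := ⟨Or.inl h0, Or.inl (by simpa using h1)⟩

theorem starConvex_slitPlane_half {z : ℂ} (hz : z ∈ Complex.slitPlane) {a b : ℝ} (ha : 0 ≤ a)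
    (hb : 0 ≤ b) (hab : a + b = 1) : (a : ℂ) * (1 / 2) + b * z ∈ Complex.slitPlane := by
  rw [Complex.mem_slitPlane_iff] at hz ⊢
  have e1 : ((a : ℂ) * (1 / 2) + b * z).re = a / 2 + b * z.re := by simp; ring
  have e2 : ((a : ℂ) * (1 / 2) + b * z).im = b * z.im := by simp
  rw [e1, e2]
  rcases hb.lt_or_eq with hb | rfl
  · rcases hz with h | h
    · left; positivity
    · right; exact mul_ne_zero hb.ne' h
  · left
    have : a = 1 := by linarith
    norm_num [this]

theorem starConvex_doublySlitPlane : StarConvex ℝ (1 / 2 : ℂ) doublySlitPlane := by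
  intro z hz a b ha hb hab
  have h1 := starConvex_slitPlane_half hz.1 ha hb hab
  have h2 := starConvex_slitPlane_half hz.2 ha hb hab
  simp only [Complex.real_smul]
  refine ⟨h1, ?_⟩
  have hab' : (a : ℂ) + b = 1 := by exact_mod_cast hab
  convert h2 using 1
  linear_combination -hab'

theorem doublySlitPlane_ne_zero {z : ℂ} (hz : z ∈ doublySlitPlane) : z ≠ 0 :=
  Complex.slitPlane_ne_zero hz.1

theorem doublySlitPlane_one_sub_ne_zero {z : ℂ} (hz : z ∈ doublySlitPlane) : 1 - z ≠ 0 :=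
  Complex.slitPlane_ne_zero hz.2

theorem mul_mem_slitPlane_of_im_mul_im_nonpos {x y : ℂ} (hx : x ∈ Complex.slitPlane)
    (hy : y ∈ Complex.slitPlane) (h : x.im * y.im ≤ 0) : x * y ∈ Complex.slitPlane := by
  have hx' := Complex.mem_slitPlane_iff_arg.1 hx
  have hy' := Complex.mem_slitPlane_iff_arg.1 hy
  refine Complex.mem_slitPlane_iff_arg.2 ⟨?_, mul_ne_zero hx'.2 hy'.2⟩
  have hl := congrArg Complex.im (log_mul_of_im_mul_im_nonpos hx hy h)
  rw [Complex.add_im, Complex.log_im, Complex.log_im, Complex.log_im] at hl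
  have h1 := Complex.neg_pi_lt_arg x
  have h2 := Complex.neg_pi_lt_arg y
  have h3 := lt_of_le_of_ne (Complex.arg_le_pi x) hx'.1
  have h4 := lt_of_le_of_ne (Complex.arg_le_pi y) hy'.1
  rw [hl]
  rcases mul_nonpos_iff.1 h with ⟨ha, hb⟩ | ⟨ha, hb⟩
  · have h6 := arg_nonpos_of_mem_slitPlane hy hb
    linarith
  · have h6 := arg_nonpos_of_mem_slitPlane hx ha
    linarith

theorem mul_one_sub_mem_slitPlane {z : ℂ} (hz : z ∈ doublySlitPlane) :
    z * (1 - z) ∈ Complex.slitPlane :=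
  mul_mem_slitPlane_of_im_mul_im_nonpos hz.1 hz.2 (by
    simp only [Complex.sub_im, Complex.one_im]
    nlinarith [sq_nonneg z.im])

theorem log_one_div_mul_one_sub {z : ℂ} (hz : z ∈ doublySlitPlane) :
    Complex.log (1 / (z * (1 - z))) = -Complex.log z - Complex.log (1 - z) := by
  rw [one_div, Complex.log_inv _ (Complex.mem_slitPlane_iff_arg.1 (mul_one_sub_mem_slitPlane hz)).1,
    log_mul_of_im_mul_im_nonpos hz.1 hz.2 (by
      simp only [Complex.sub_im, Complex.one_im]
      nlinarith [sq_nonneg z.im])]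
  ring

theorem pfaff_im_neg {z : ℂ} (hz : 0 < z.im) : (z / (z - 1)).im < 0 := by
  have h0 : z - 1 ≠ 0 := by intro h; have := congrArg Complex.im h; simp at this; exact hz.ne' this
  have e : z / (z - 1) = 1 - (1 - z)⁻¹ := by
    have h0' : 1 - z ≠ 0 := by rwa [← neg_sub, neg_ne_zero]
    field_simp
    ring
  rw [e]
  have := inv_im_pos (u := 1 - z) (by simpa using hz)
  simpa using this

theorem one_sub_pfaff {z : ℂ} (hz : 1 - z ≠ 0) : 1 - z / (z - 1) = (1 - z)⁻¹ := by
  have h0' : z - 1 ≠ 0 := by rwa [← neg_sub, neg_ne_zero]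
  field_simp
  ring

/-- Pfaff's formula rewrites the denominator, and the connection formula at u = 1-z, which lies in
the lower half-plane, rewrites the numerator; the factors (1-z)^(1/2) cancel. -/
theorem lambdaInv_pfaff {z : ℂ} (hz : 0 < z.im) : lambdaInv (z / (z - 1)) = lambdaInv z - 1 := by
  have hU := mem_doublySlitPlane_of_im hz.ne'
  have h0 := doublySlitPlane_one_sub_ne_zero hU
  have hF := hyperF_ne_zero hU.2
  have h1 := hyperF_inv (u := 1 - z) (by simpa using hz)
  rw [sub_sub_cancel] at h1
  have h2 : (1 - z) ^ (1 / 2 : ℂ) ≠ 0 := by simp [Complex.cpow_eq_zero_iff, h0]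
  rw [Complex.cpow_neg, inv_mul_eq_iff_eq_mul₀ h2] at h1
  rw [lambdaInv, lambdaInv, one_sub_pfaff h0, hyperF_pfaff hU.2, h1]
  field_simp
  rw [mul_add, ← mul_assoc, Complex.I_mul_I]
  ring

/-- Under the map, -log z - log(1-z) becomes -log z + 2 log(1-z) + πi. Relative to the original, the
prefactor gains (1-z)^(c/8) e^(πic/24), and the shift of λ⁻¹ contributes e^(-2πi(h-c/24)). The
phases combine to e^(-2πi(h-c/16)). -/
theorem confH_pfaff {c : ℕ} (hc : c = 8 ∨ c = 24) (h : ℝ) {z : ℂ} (hz : 0 < z.im) :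
    Complex.exp (2 * Real.pi * Complex.I * ((h - c / 16 : ℝ) : ℂ)) * confH c h (z / (z - 1)) =
      confH c h z * (1 - z) ^ (c / 8) := by
  have hU := mem_doublySlitPlane_of_im hz.ne'
  have h0 := doublySlitPlane_one_sub_ne_zero hU
  have hV := mem_doublySlitPlane_of_im (pfaff_im_neg hz).ne
  have hz1 : 0 < (z - 1).im := by simpa using hz
  have hs1 : z - 1 ∈ Complex.slitPlane := Or.inr hz1.ne'
  have hl1 : Complex.log (z - 1) = Complex.log (1 - z) + Real.pi * Complex.I := by
    rw [← neg_sub, Complex.log, Complex.log, norm_neg,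
      Complex.arg_neg_eq_arg_add_pi_of_im_neg (by simpa using hz)]
    push_cast
    ring
  have hl2 : Complex.log (z / (z - 1)) = Complex.log z - Complex.log (z - 1) := by
    rw [div_eq_mul_inv, log_mul_of_im_mul_im_nonpos hU.1 (inv_mem_slitPlane hs1)
      (im_mul_inv_im_nonpos (mul_nonneg hz.le hz1.le)),
      Complex.log_inv _ (Complex.mem_slitPlane_iff_arg.1 hs1).1]
    ring
  have hl3 : Complex.log (1 - z / (z - 1)) = -Complex.log (1 - z) := by
    rw [one_sub_pfaff h0, Complex.log_inv _ (Complex.mem_slitPlane_iff_arg.1 hU.2).1]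
  have hpow : (1 - z) ^ (c / 8) = Complex.exp (((c / 8 : ℕ) : ℂ) * Complex.log (1 - z)) := by
    rw [Complex.exp_nat_mul, Complex.exp_log h0]
  have hn1 : 1 / (z * (1 - z)) ≠ 0 :=
    one_div_ne_zero (mul_ne_zero (doublySlitPlane_ne_zero hU) h0)
  have hn2 : 1 / (z / (z - 1) * (1 - z / (z - 1))) ≠ 0 :=
    one_div_ne_zero (mul_ne_zero (doublySlitPlane_ne_zero hV) (doublySlitPlane_one_sub_ne_zero hV))
  have hc8 : ((c / 8 : ℕ) : ℂ) = (c : ℂ) / 8 := by rcases hc with rfl | rfl <;> norm_num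
  rw [confH, confH, hpow, lambdaInv_pfaff hz, Complex.cpow_def_of_ne_zero hn1,
    Complex.cpow_def_of_ne_zero hn2, log_one_div_mul_one_sub hU, log_one_div_mul_one_sub hV,
    hl2, hl3, hl1, hc8]
  simp only [← Complex.exp_add]
  congr 1
  push_cast
  ring

/-- The factor -1/(z-1)² is the derivative of z/(z-1), so this is an identity of differentials. -/
theorem confH_mul_magicB {c : ℕ} (hc : c = 8 ∨ c = 24) (h : ℝ) {z : ℂ} (hz : 0 < z.im) :
    confH c h z * magicB c z =
      Complex.exp (2 * Real.pi * Complex.I * ((h - c / 16 : ℝ) : ℂ)) *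
        (confH c h (z / (z - 1)) * magicA c (z / (z - 1)) * (-1 / (z - 1) ^ 2)) := by
  have h0 := doublySlitPlane_one_sub_ne_zero (mem_doublySlitPlane_of_im hz.ne')
  have h1 := confH_pfaff hc h hz
  have h2 : (z - 1) ^ 2 = (1 - z) ^ 2 := by ring
  rw [magicB, zpow_sub₀ h0, zpow_natCast, h2]
  have h3 : (1 - z) ^ (2 : ℤ) = (1 - z) ^ 2 := by norm_cast
  rw [h3]
  linear_combination (magicA c (z / (z - 1)) * (1 / (1 - z) ^ 2)) * h1

/-! ### Rational identities, reflection symmetry and holomorphy. -/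

/-- Written in z(1-z), `magicB` is visibly invariant under z ↦ 1-z. -/
theorem magicB_eq {c : ℕ} (hc : c = 8 ∨ c = 24) {z : ℂ} (h0 : z ≠ 0) (h1 : 1 - z ≠ 0) :
    magicB c z = -(2 - ((c + 32) / 8) * (z * (1 - z))) / (z * (1 - z)) ^ 2 := by
  have h1' : z - 1 ≠ 0 := by rwa [← neg_sub, neg_ne_zero]
  have e : z / (z - 1) = 1 - (1 - z)⁻¹ := by rw [← one_sub_pfaff h1]; ring
  rcases hc with rfl | rfl
  · rw [magicB, magicA, if_pos rfl, e]
    norm_num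
    have : 1 - (1 - z)⁻¹ ≠ 0 := by
      rw [← e]; exact div_ne_zero h0 h1'
    rw [← e]
    field_simp
    ring
  · rw [magicB, magicA, if_neg (by norm_num), if_pos rfl, e]
    norm_num
    have : 1 - (1 - z)⁻¹ ≠ 0 := by
      rw [← e]; exact div_ne_zero h0 h1'
    rw [← e]
    field_simp
    ring

theorem magicB_one_sub {c : ℕ} (hc : c = 8 ∨ c = 24) {z : ℂ} (h0 : z ≠ 0) (h1 : 1 - z ≠ 0) :
    magicB c (1 - z) = magicB c z := by
  rw [magicB_eq hc h0 h1, magicB_eq hc h1 (by rwa [sub_sub_cancel]), sub_sub_cancel,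
    mul_comm (1 - z) z]

/-- Besides matching the two integrals, this shows that the double poles of `magicA` and `magicB` at
0 cancel: the sum even vanishes there. -/
theorem magicA_add_magicB {c : ℕ} (hc : c = 8 ∨ c = 24) {z : ℂ} (h0 : z ≠ 0) (h1 : 1 - z ≠ 0) :
    magicA c z + magicB c z = -magicA c (1 - z) := by
  rw [magicB_eq hc h0 h1]
  rcases hc with rfl | rfl
  · rw [magicA, magicA, if_pos rfl, if_pos rfl]
    push_cast
    field_simp
    ring
  · rw [magicA, magicA, if_neg (by norm_num), if_pos rfl, if_neg (by norm_num), if_pos rfl]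
    push_cast
    field_simp
    ring

theorem magicA_conj (c : ℕ) (z : ℂ) :
    magicA c ((starRingEnd ℂ) z) = (starRingEnd ℂ) (magicA c z) := by
  unfold magicA
  split_ifs <;> simp [map_ofNat]

theorem magicB_conj (c : ℕ) (z : ℂ) :
    magicB c ((starRingEnd ℂ) z) = (starRingEnd ℂ) (magicB c z) := by
  have h := magicA_conj c (z / (z - 1))
  simp only [map_div₀, map_sub, map_one] at h
  unfold magicB
  simp [h]

theorem differentiableAt_magicA (c : ℕ) {z : ℂ} (h0 : z ≠ 0) :
    DifferentiableAt ℂ (magicA c) z := by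
  unfold magicA
  split_ifs
  · exact DifferentiableAt.div (by fun_prop) (by fun_prop) (pow_ne_zero 2 h0)
  · exact DifferentiableAt.div (by fun_prop) (by fun_prop) (pow_ne_zero 2 h0)
  · fun_prop

theorem differentiableAt_magicB (c : ℕ) {z : ℂ} (h0 : z ≠ 0) (h1 : 1 - z ≠ 0) :
    DifferentiableAt ℂ (magicB c) z := by
  have h1' : z - 1 ≠ 0 := by rwa [← neg_sub, neg_ne_zero]
  unfold magicB
  refine DifferentiableAt.neg (DifferentiableAt.mul ?_ ?_)
  · exact (by fun_prop : DifferentiableAt ℂ (fun z : ℂ => 1 - z) z).zpow (Or.inl h1)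
  · exact (differentiableAt_magicA c (div_ne_zero h0 h1')).comp z
      (f := fun z => z / (z - 1)) (DifferentiableAt.div (by fun_prop) (by fun_prop) h1')

theorem differentiableAt_hyperF {z : ℂ} (hz : 1 - z ∈ Complex.slitPlane) :
    DifferentiableAt ℂ hyperF z :=
  differentiableOn_hyperF.differentiableAt
    ((Complex.isOpen_slitPlane.preimage (by fun_prop : Continuous fun z : ℂ => 1 - z)).mem_nhds hz)

theorem differentiableAt_confH (c h : ℝ) {z : ℂ} (hz : z ∈ doublySlitPlane) :
    DifferentiableAt ℂ (confH c h) z := by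
  have h0 := doublySlitPlane_ne_zero hz
  have h1 := doublySlitPlane_one_sub_ne_zero hz
  have hF : DifferentiableAt ℂ (fun z => hyperF (1 - z)) z :=
    (differentiableAt_hyperF (z := 1 - z) (one_sub_mem_doublySlitPlane hz).2).comp z
      (f := fun z => 1 - z) (by fun_prop)
  have hl : DifferentiableAt ℂ lambdaInv z :=
    (hF.const_mul _).div (differentiableAt_hyperF hz.2) (hyperF_ne_zero hz.2)
  unfold confH
  refine DifferentiableAt.mul ?_ ?_
  · refine DifferentiableAt.cpow_const ?_ ?_
    · exact DifferentiableAt.div (by fun_prop) (by fun_prop) (mul_ne_zero h0 h1)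
    · rw [one_div]
      exact inv_mem_slitPlane (mul_one_sub_mem_slitPlane hz)
  · exact (hl.const_mul _).cexp

theorem confH_conj (c h : ℝ) {z : ℂ} (hz : z ∈ doublySlitPlane) :
    confH c h ((starRingEnd ℂ) z) = (starRingEnd ℂ) (confH c h z) := by
  have h1 : hyperF (1 - (starRingEnd ℂ) z) = (starRingEnd ℂ) (hyperF (1 - z)) := by
    rw [← hyperF_conj (one_sub_mem_doublySlitPlane hz).2]
    simp
  have hs : (1 / (z * (1 - z))).arg ≠ Real.pi := by
    rw [one_div]
    exact (Complex.mem_slitPlane_iff_arg.1 (inv_mem_slitPlane (mul_one_sub_mem_slitPlane hz))).1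
  have h2 := Complex.conj_cpow _ ((c / 24 : ℝ) : ℂ) hs
  rw [Complex.conj_ofReal] at h2
  unfold confH lambdaInv
  rw [map_mul, ← h2, ← Complex.exp_conj, hyperF_conj hz.2, h1]
  simp only [map_mul, map_div₀, map_sub, map_one, Complex.conj_ofReal, Complex.conj_I, map_ofNat]
  ring_nf

/-! ### Size of `confH` and of its products with `magicA`. -/

theorem lambdaInv_im (z : ℂ) : (lambdaInv z).im = (hyperF (1 - z) / hyperF z).re := by
  rw [lambdaInv, mul_div_assoc, Complex.I_mul_im]

theorem norm_confH (c h : ℝ) (z : ℂ) :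
    ‖confH c h z‖ = ‖z * (1 - z)‖ ^ (-(c / 24)) *
      Real.exp (-(2 * Real.pi * (h - c / 24) * (hyperF (1 - z) / hyperF z).re)) := by
  rw [confH, norm_mul, Complex.norm_cpow_real, norm_div, norm_one, one_div,
    Real.inv_rpow (norm_nonneg _), Real.rpow_neg (norm_nonneg _), Complex.norm_exp, ← lambdaInv_im]
  congr 2
  rw [show 2 * (Real.pi : ℂ) * Complex.I * ((-(c / 24) + h : ℝ) : ℂ) * lambdaInv z =
    ((2 * Real.pi * (-(c / 24) + h) : ℝ) : ℂ) * (Complex.I * lambdaInv z) by push_cast; ring,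
    Complex.re_ofReal_mul, Complex.I_mul_re]
  ring

/-- In the strip both `hyperF z` and `hyperF (1 - z)` lie in the sector |arg| ≤ π/4, so their
quotient has |arg| ≤ π/2. -/
theorem re_hyperF_ratio_nonneg {z : ℂ} (h0 : 0 < z.re) (h1 : z.re < 1) :
    0 ≤ (hyperF (1 - z) / hyperF z).re := by
  have a := abs_hyperF_im_le h1
  have b := abs_hyperF_im_le (z := 1 - z) (by simpa using h0)
  rw [Complex.div_re, ← add_div]
  refine div_nonneg ?_ (Complex.normSq_nonneg _)
  have := mul_le_mul b a (abs_nonneg _) ((abs_nonneg _).trans b)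
  rw [← abs_mul] at this
  linarith [neg_abs_le ((hyperF (1 - z)).im * (hyperF z).im)]

theorem norm_confH_le {c h : ℝ} (hch : c / 24 ≤ h) {z : ℂ} (h0 : 0 < z.re) (h1 : z.re < 1) :
    ‖confH c h z‖ ≤ ‖z * (1 - z)‖ ^ (-(c / 24)) := by
  rw [norm_confH]
  refine mul_le_of_le_one_right (Real.rpow_nonneg (norm_nonneg _) _) (Real.exp_le_one_iff.2 ?_)
  have := re_hyperF_ratio_nonneg h0 h1
  have h2 : 0 ≤ h - c / 24 := by linarith
  have := Real.pi_pos
  rw [neg_nonpos]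
  positivity

theorem confH_ofReal (c h : ℝ) {x : ℝ} (hx : x ∈ Ioo (0 : ℝ) 1) :
    ∃ r : ℝ, 0 ≤ r ∧ confH c h x = r := by
  have hU : (x : ℂ) ∈ doublySlitPlane :=
    mem_doublySlitPlane_of_re (by simpa using hx.1) (by simpa using hx.2)
  have hF : ∀ y : ℝ, 1 - (y : ℂ) ∈ Complex.slitPlane → hyperF y = ((hyperF y).re : ℂ) :=
    fun y hy => by
      have := hyperF_conj hy
      rw [Complex.conj_ofReal] at this
      exact (Complex.conj_eq_iff_re.1 this.symm).symm
  have h1 := hF x hU.2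
  have h2 := hF (1 - x) (by simpa using hU.1)
  push_cast at h2
  have hpos : 0 < 1 / (x * (1 - x)) := one_div_pos.2 (mul_pos hx.1 (by linarith [hx.2]))
  refine ⟨(1 / (x * (1 - x))) ^ (c / 24) * Real.exp (-(2 * Real.pi * (-(c / 24) + h) *
    ((hyperF (1 - x)).re / (hyperF x).re))), by positivity, ?_⟩
  rw [confH, lambdaInv, h1, h2]
  push_cast [Complex.ofReal_cpow hpos.le]
  congr 2
  linear_combination (2 * Real.pi * (-(c / 24 : ℂ) + h) *
    ((hyperF (1 - x)).re / (hyperF x).re)) *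
    Complex.I_mul_I

theorem magicA_ofReal {c : ℕ} (hc : c = 8 ∨ c = 24) {x : ℝ} (hx : x ∈ Ioo (0 : ℝ) 1) :
    ∃ r : ℝ, 0 ≤ r ∧ magicA c x = r := by
  have h1 : 0 ≤ 1 - x := by linarith [hx.2]
  have h0 := hx.1
  rcases hc with rfl | rfl
  · refine ⟨(1 - x) * (2 * x ^ 2 + x + 2) / x ^ 2, by positivity, ?_⟩
    rw [magicA, if_pos rfl]
    push_cast
    rfl
  · refine ⟨(1 - x) ^ 3 * (2 * x ^ 2 + 3 * x + 2) / x ^ 2, by positivity, ?_⟩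
    rw [magicA, if_neg (by norm_num), if_pos rfl]
    push_cast
    rfl

theorem norm_magicA_le {c : ℕ} (hc : c = 8 ∨ c = 24) {z : ℂ} (h0 : ‖z‖ ≤ 3 / 2)
    (h1 : ‖1 - z‖ ≤ 3 / 2) : ‖magicA c z‖ ≤ 25 * ‖1 - z‖ / ‖z‖ ^ 2 := by
  have hz2 : ‖z‖ ^ 2 ≤ 9 / 4 := by nlinarith [norm_nonneg z]
  have hw2 : ‖1 - z‖ ^ 2 ≤ 9 / 4 := by nlinarith [norm_nonneg (1 - z)]
  rcases hc with rfl | rfl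
  · have hq : ‖2 * z ^ 2 + z + 2‖ ≤ 25 := by
      refine (norm_add₃_le).trans ?_
      simp only [norm_mul, norm_pow, Complex.norm_ofNat]
      linarith
    rw [magicA, if_pos rfl, norm_div, norm_mul, norm_pow]
    refine div_le_div_of_nonneg_right ?_ (by positivity)
    nlinarith [norm_nonneg (1 - z)]
  · have hq : ‖2 * z ^ 2 + 3 * z + 2‖ ≤ 11 := by
      refine (norm_add₃_le).trans ?_
      simp only [norm_mul, norm_pow, Complex.norm_ofNat]
      linarith
    rw [magicA, if_neg (by norm_num), if_pos rfl, norm_div, norm_mul, norm_pow, norm_pow]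
    refine div_le_div_of_nonneg_right ?_ (by positivity)
    calc ‖1 - z‖ ^ 3 * ‖2 * z ^ 2 + 3 * z + 2‖
        = ‖1 - z‖ * (‖1 - z‖ ^ 2 * ‖2 * z ^ 2 + 3 * z + 2‖) := by ring
      _ ≤ ‖1 - z‖ * (9 / 4 * 11) := by gcongr
      _ ≤ _ := by nlinarith [norm_nonneg (1 - z)]

/-- Near 1 the weight has a singularity of order c/24 ≤ 1, which the zero of `magicA` at 1
compensates. -/
theorem weight_mul_magicA_le {c : ℕ} (hc : c = 8 ∨ c = 24) {z : ℂ} (h1 : z.re < 1)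
    (hz : ‖1 - z‖ ≤ 1 / 2) :
    ‖z * (1 - z)‖ ^ (-((c : ℝ) / 24)) * ‖magicA c z‖ ≤ 200 := by
  have hw : 0 < ‖1 - z‖ := norm_pos_iff.2 fun h => by
    have := congrArg Complex.re h
    simp at this
    linarith
  have hz1 : 1 / 2 ≤ ‖z‖ := by
    have := norm_sub_norm_le (1 : ℂ) (1 - z)
    rw [sub_sub_cancel, norm_one] at this
    linarith
  have hz2 : ‖z‖ ≤ 3 / 2 := by
    have := norm_sub_le (1 : ℂ) (1 - z)
    rw [sub_sub_cancel, norm_one] at this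
    linarith
  have hz0 : 0 < ‖z‖ := by linarith
  have hm : 0 < ‖z * (1 - z)‖ := by rw [norm_mul]; positivity
  have hm1 : ‖z * (1 - z)‖ ≤ 1 := by rw [norm_mul]; nlinarith
  have hA := norm_magicA_le hc hz2 (by linarith)
  have hp : ‖z * (1 - z)‖ ^ (-((c : ℝ) / 24)) ≤ (‖z‖ * ‖1 - z‖)⁻¹ := by
    rw [← norm_mul, ← Real.rpow_neg_one]
    refine Real.rpow_le_rpow_of_exponent_ge hm hm1 ?_
    rcases hc with rfl | rfl <;> norm_num
  calc _ ≤ (‖z‖ * ‖1 - z‖)⁻¹ * (25 * ‖1 - z‖ / ‖z‖ ^ 2) := by gcongr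
    _ = 25 * (‖z‖⁻¹) ^ 3 := by field_simp
    _ ≤ 25 * 2 ^ 3 := by
      gcongr
      rw [inv_le_comm₀ hz0 two_pos]
      linarith
    _ = 200 := by norm_num

theorem norm_confH_mul_magicA_le {c : ℕ} (hc : c = 8 ∨ c = 24) {h : ℝ} (hch : (c : ℝ) / 24 ≤ h)
    {z : ℂ} (h0 : 0 < z.re) (h1 : z.re < 1) (hz : ‖1 - z‖ ≤ 1 / 2) :
    ‖confH c h z * magicA c z‖ ≤ 200 ∧ ‖confH c h (1 - z) * magicA c z‖ ≤ 200 := by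
  have hb := weight_mul_magicA_le hc h1 hz
  have e1 := norm_confH_le hch h0 h1
  have e2 := norm_confH_le hch (z := 1 - z) (by simpa using h1) (by simpa using h0)
  rw [sub_sub_cancel, mul_comm (1 - z)] at e2
  constructor
  · rw [norm_mul]
    exact (mul_le_mul_of_nonneg_right e1 (norm_nonneg _)).trans hb
  · rw [norm_mul]
    exact (mul_le_mul_of_nonneg_right e2 (norm_nonneg _)).trans hb

/-- Near 0, 1/`hyperF z` = 1 + d with |d| < η/2. As |Im X| ≤ Re X for X = `hyperF (1 - z)`,
multiplication by 1 + d lowers Re X by at most the factor 1-η; then the logarithmic lower bound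
applies. -/
theorem eventually_re_hyperF_ratio {η : ℝ} (h0 : 0 < η) (h1 : η < 1) :
    ∃ δ : ℝ, 0 < δ ∧ δ ≤ 1 / 2 ∧ ∀ z : ℂ, 0 < z.re → ‖z‖ < δ →
      (1 - η) * Real.log (1 / ‖z‖) ≤ Real.pi * (hyperF (1 - z) / hyperF z).re := by
  have hF0 : hyperF 0 = 1 := by
    rw [hyperF_eq_ordinaryHypergeometric (by simp), ordinaryHypergeometric_zero]
  have hc : ContinuousAt (fun z => (hyperF z)⁻¹) 0 :=
    (differentiableAt_hyperF (by simp)).continuousAt.inv₀ (by rw [hF0]; exact one_ne_zero)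
  obtain ⟨δ, hδ, hball⟩ := Metric.continuousAt_iff.1 hc (η / 2) (by linarith)
  refine ⟨min δ (1 / 2), by positivity, min_le_right _ _, fun z hz hzδ => ?_⟩
  have hd := hball (x := z) (by simpa using hzδ.trans_le (min_le_left _ _))
  rw [hF0, inv_one, dist_eq_norm] at hd
  have hz1 : 0 < ‖z‖ := norm_pos_iff.2 (by rintro rfl; simp at hz)
  have hzl : ‖z‖ < 1 / 2 := hzδ.trans_le (min_le_right _ _)
  have hlog : 0 ≤ Real.log (1 / ‖z‖) := Real.log_nonneg (by
    rw [le_div_iff₀ hz1]; linarith)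
  have hl := log_le_hyperF_one_sub hz
  have hi := abs_hyperF_im_le (z := 1 - z) (by simpa using hz)
  set X := hyperF (1 - z)
  set d := (hyperF z)⁻¹ - 1 with hdd
  have e : X / hyperF z = X * (1 + d) := by rw [hdd]; ring
  have hdr := abs_le.1 (Complex.abs_re_le_norm d)
  have hXr : 0 ≤ X.re := (abs_nonneg _).trans hi
  have hprod : X.im * d.im ≤ X.re * (η / 2) := by
    refine (le_abs_self _).trans ?_
    rw [abs_mul]
    exact mul_le_mul hi ((Complex.abs_im_le_norm d).trans hd.le) (abs_nonneg _) hXr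
  have hre : (1 - η) * X.re ≤ (X / hyperF z).re := by
    rw [e, Complex.mul_re]
    simp only [Complex.add_re, Complex.add_im, Complex.one_re, Complex.one_im, zero_add]
    nlinarith
  calc (1 - η) * Real.log (1 / ‖z‖) ≤ (1 - η) * (Real.pi * X.re) := by
        have : 0 ≤ 1 - η := by linarith
        gcongr
    _ = Real.pi * ((1 - η) * X.re) := by ring
    _ ≤ _ := by
        have := Real.pi_pos
        gcongr

/-- Up to the loss η, `confH` decays like ‖z‖ to the power 2(h-c/24) - c/24, while `magicA` has a
double pole; the product is O(‖z‖^(κ-1)) precisely because h exceeds the threshold. -/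
theorem confH_mul_magicA_bound_zero {c : ℕ} (hc : c = 8 ∨ c = 24) {h : ℝ}
    (hh : (c : ℝ) / 16 + 1 / 2 < h) :
    ∃ κ : ℝ, 0 < κ ∧ ∃ δ : ℝ, 0 < δ ∧ δ ≤ 1 / 2 ∧ ∀ z : ℂ, 0 < z.re → ‖z‖ < δ →
      ‖confH c h z * magicA c z‖ * ‖z‖ ≤ 75 * ‖z‖ ^ κ := by
  have hc0 : (0 : ℝ) ≤ c := Nat.cast_nonneg c
  have hc24 : (c : ℝ) / 24 ≤ 1 := by rcases hc with rfl | rfl <;> norm_num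
  set β : ℝ := h - c / 24 with hβ
  have hβ0 : 0 < β := by linarith
  -- s is the exponent available for η = 0. The choice η = s/(4β) spends half of it, which leaves κ
  -- = s/2.
  set s : ℝ := 2 * h - c / 8 - 1 with hs
  have hs0 : 0 < s := by linarith
  have hsβ : s < 4 * β := by linarith
  obtain ⟨δ, hδ, hδ2, hb⟩ := eventually_re_hyperF_ratio (η := s / (4 * β)) (by positivity)
    ((div_lt_one (by positivity)).2 hsβ)
  refine ⟨s / 2, by positivity, δ, hδ, hδ2, fun z hz hzδ => ?_⟩
  have hr := hb z hz hzδ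
  have hz0 : 0 < ‖z‖ := norm_pos_iff.2 (by rintro rfl; simp at hz)
  have hzl : ‖z‖ < 1 / 2 := hzδ.trans_le hδ2
  have hw1 : 1 / 2 ≤ ‖1 - z‖ := by
    have := norm_sub_norm_le (1 : ℂ) z
    rw [norm_one] at this
    linarith
  have hw2 : ‖1 - z‖ ≤ 3 / 2 := by
    have := norm_sub_le (1 : ℂ) z
    rw [norm_one] at this
    linarith
  have hA := norm_magicA_le hc (by linarith) hw2
  have hexp : Real.exp (-(2 * Real.pi * β * (hyperF (1 - z) / hyperF z).re)) ≤
      ‖z‖ ^ (2 * β * (1 - s / (4 * β))) := by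
    rw [Real.rpow_def_of_pos hz0]
    refine Real.exp_le_exp.2 ?_
    rw [one_div, Real.log_inv] at hr
    nlinarith
  have hwt : ‖z * (1 - z)‖ ^ (-((c : ℝ) / 24)) ≤ ‖z‖ ^ (-((c : ℝ) / 24)) * 2 := by
    rw [norm_mul, Real.mul_rpow hz0.le (norm_nonneg _)]
    gcongr
    calc ‖1 - z‖ ^ (-((c : ℝ) / 24)) ≤ (1 / 2) ^ (-((c : ℝ) / 24)) :=
          Real.rpow_le_rpow_of_nonpos (by norm_num) hw1 (by
            linarith [div_nonneg hc0 (by norm_num : (0 : ℝ) ≤ 24)])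
      _ ≤ (1 / 2) ^ (-1 : ℝ) :=
          Real.rpow_le_rpow_of_exponent_ge (by norm_num) (by norm_num) (by linarith)
      _ = 2 := by rw [Real.rpow_neg_one]; norm_num
  rw [norm_mul, norm_confH, ← hβ]
  calc _ ≤ ‖z‖ ^ (-((c : ℝ) / 24)) * 2 * ‖z‖ ^ (2 * β * (1 - s / (4 * β))) *
        (25 * (3 / 2) / ‖z‖ ^ 2) * ‖z‖ := by
          gcongr
          exact hA.trans (by gcongr)
    _ = 75 * (‖z‖ ^ (-((c : ℝ) / 24)) * ‖z‖ ^ (2 * β * (1 - s / (4 * β))) * (‖z‖)⁻¹) := by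
          field_simp
          ring
    _ = 75 * ‖z‖ ^ (s / 2) := by
          rw [← Real.rpow_add hz0, ← Real.rpow_neg_one ‖z‖, ← Real.rpow_add hz0]
          congr 2
          field_simp
          rw [hβ, hs]
          ring

theorem differentiableAt_confH_mul_magicA (c : ℕ) (h : ℝ) {z : ℂ} (hz : z ∈ doublySlitPlane) :
    DifferentiableAt ℂ (fun z => confH c h z * magicA c z) z :=
  (differentiableAt_confH c h hz).mul (differentiableAt_magicA c (doublySlitPlane_ne_zero hz))

theorem differentiableAt_confH_mul_magicB (c : ℕ) (h : ℝ) {z : ℂ} (hz : z ∈ doublySlitPlane) :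
    DifferentiableAt ℂ (fun z => confH c h z * magicB c z) z :=
  (differentiableAt_confH c h hz).mul
    (differentiableAt_magicB c (doublySlitPlane_ne_zero hz) (doublySlitPlane_one_sub_ne_zero hz))

theorem differentiableAt_slashIdSubS (c h : ℝ) {z : ℂ} (hz : z ∈ doublySlitPlane) :
    DifferentiableAt ℂ (slashIdSubS (confH c h)) z :=
  (differentiableAt_confH c h hz).sub
    ((differentiableAt_confH c h (one_sub_mem_doublySlitPlane hz)).comp z
      (f := fun z => 1 - z) (by fun_prop))

/-! ### Absolute convergence of the two integrals. -/

theorem half_add_mul_I_mem (t : ℝ) : (1 / 2 + (t : ℂ) * Complex.I) ∈ doublySlitPlane :=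
  mem_doublySlitPlane_of_re (by simp) (by norm_num)

theorem intervalIntegrable_slash_mul_magicA {c : ℕ} (hc : c = 8 ∨ c = 24) {h : ℝ}
    (hch : (c : ℝ) / 24 ≤ h) :
    IntervalIntegrable (fun x : ℝ => slashIdSubS (confH c h) (x : ℂ) * magicA c (x : ℂ))
      volume (1 / 2) 1 := by
  rw [intervalIntegrable_iff_integrableOn_Ioo_of_le (by norm_num)]
  have hm : AEStronglyMeasurable
      (fun x : ℝ => slashIdSubS (confH c h) (x : ℂ) * magicA c (x : ℂ))
      (volume.restrict (Ioo (1 / 2) 1)) := by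
    refine ContinuousOn.aestronglyMeasurable (s := Ioo (1 / 2 : ℝ) 1) (fun x hx => ?_)
      measurableSet_Ioo
    have hU : (x : ℂ) ∈ doublySlitPlane :=
      mem_doublySlitPlane_of_re (by simp; linarith [hx.1]) (by simpa using hx.2)
    have hd := (differentiableAt_slashIdSubS c h hU).mul
      (differentiableAt_magicA c (doublySlitPlane_ne_zero hU))
    exact (ContinuousAt.comp (f := fun x : ℝ => (x : ℂ)) hd.continuousAt
      Complex.continuous_ofReal.continuousAt).continuousWithinAt
  have hbd : ∀ x ∈ Ioo (1 / 2 : ℝ) 1,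
      ‖slashIdSubS (confH c h) (x : ℂ) * magicA c (x : ℂ)‖ ≤ 400 := by
    intro x hx
    have hb := norm_confH_mul_magicA_le hc hch (z := x) (by simp; linarith [hx.1])
      (by simpa using hx.2) (by
        rw [show (1 - (x : ℂ)) = ((1 - x : ℝ) : ℂ) by push_cast; rfl, Complex.norm_real,
          Real.norm_of_nonneg (by linarith [hx.2])]
        linarith [hx.1])
    rw [slashIdSubS, sub_mul]
    exact (norm_sub_le _ _).trans (by linarith [hb.1, hb.2])
  refine Integrable.mono' (g := fun _ => 400) (integrableOn_const (by simp)) hm ?_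
  filter_upwards [self_mem_ae_restrict measurableSet_Ioo] with x hx using hbd x hx

theorem integrableOn_slash_mul_magicB {c : ℕ} (hc : c = 8 ∨ c = 24) {h : ℝ}
    (hch : (c : ℝ) / 24 ≤ h) :
    IntegrableOn (fun t : ℝ => slashIdSubS (confH c h) (1 / 2 + (t : ℂ) * Complex.I) *
      magicB c (1 / 2 + (t : ℂ) * Complex.I) * Complex.I) (Ioi 0) := by
  have hc0 : (0 : ℝ) ≤ c / 24 := by positivity
  have hc24 : (c : ℝ) / 24 ≤ 1 := by rcases hc with rfl | rfl <;> norm_num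
  have hc32 : ((c : ℝ) + 32) / 8 ≤ 7 := by rcases hc with rfl | rfl <;> norm_num
  refine Integrable.mono' ((integrable_inv_one_add_sq.const_mul 480).integrableOn) ?_ ?_
  · refine ContinuousOn.aestronglyMeasurable (fun t _ => ?_) measurableSet_Ioi
    have hU := half_add_mul_I_mem t
    have hd := (differentiableAt_slashIdSubS c h hU).mul (differentiableAt_magicB c
      (doublySlitPlane_ne_zero hU) (doublySlitPlane_one_sub_ne_zero hU))
    exact (ContinuousAt.comp (f := fun t : ℝ => (1 / 2 + (t : ℂ) * Complex.I)) hd.continuousAt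
      (by fun_prop)).continuousWithinAt.mul continuousWithinAt_const
  · refine Filter.Eventually.of_forall fun t => ?_
    have hU := half_add_mul_I_mem t
    set z : ℂ := 1 / 2 + (t : ℂ) * Complex.I with hz
    have h0 : 0 < z.re := by simp [hz]
    have h1 : z.re < 1 := by norm_num [hz]
    set m : ℝ := 1 / 4 + t ^ 2 with hm
    have hm0 : 1 / 4 ≤ m := by rw [hm]; linarith [sq_nonneg t]
    have hmp : 0 < m := by linarith
    -- On the vertical line z(1-z) = 1/4 + t² is real, so the weight is bounded and `magicB` is
    -- O(1/(1+t²)).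
    have hzm : z * (1 - z) = (m : ℂ) := by
      rw [hz, hm]
      push_cast
      linear_combination (-(t : ℂ) ^ 2) * Complex.I_mul_I
    have e1 := norm_confH_le hch h0 h1
    have e2 := norm_confH_le hch (z := 1 - z) (by simpa using h1) (by simpa using h0)
    rw [sub_sub_cancel, mul_comm (1 - z)] at e2
    have hw : ‖z * (1 - z)‖ ^ (-((c : ℝ) / 24)) ≤ 4 := by
      rw [hzm, Complex.norm_real, Real.norm_of_nonneg hmp.le]
      calc m ^ (-((c : ℝ) / 24)) ≤ (1 / 4) ^ (-((c : ℝ) / 24)) :=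
            Real.rpow_le_rpow_of_nonpos (by norm_num) hm0 (by linarith)
        _ ≤ (1 / 4) ^ (-1 : ℝ) :=
            Real.rpow_le_rpow_of_exponent_ge (by norm_num) (by norm_num) (by linarith)
        _ = 4 := by rw [Real.rpow_neg_one]; norm_num
    have hB : ‖magicB c z‖ ≤ 60 * (1 + t ^ 2)⁻¹ := by
      rw [magicB_eq hc (doublySlitPlane_ne_zero hU) (doublySlitPlane_one_sub_ne_zero hU), hzm,
        show -(2 - ((c : ℂ) + 32) / 8 * m) / (m : ℂ) ^ 2 =
          ((-(2 - ((c : ℝ) + 32) / 8 * m) / m ^ 2 : ℝ) : ℂ) by push_cast; ring, Complex.norm_real,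
        norm_div, Real.norm_of_nonneg (sq_nonneg m), norm_neg]
      have hn : ‖2 - ((c : ℝ) + 32) / 8 * m‖ ≤ 15 * m := by
        rw [Real.norm_eq_abs, abs_le]
        have : 0 ≤ ((c : ℝ) + 32) / 8 * m := by positivity
        have : ((c : ℝ) + 32) / 8 * m ≤ 7 * m := by gcongr
        constructor <;> linarith
      calc _ ≤ 15 * m / m ^ 2 := by gcongr
        _ = 15 * m⁻¹ := by field_simp
        _ ≤ 15 * (4 * (1 + t ^ 2)⁻¹) := by
          gcongr
          rw [inv_le_comm₀ hmp (by positivity), mul_inv, inv_inv, hm]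
          linarith [sq_nonneg t]
        _ = _ := by ring
    rw [norm_mul, Complex.norm_I, mul_one, norm_mul, slashIdSubS]
    calc _ ≤ (4 + 4) * (60 * (1 + t ^ 2)⁻¹) := by
          gcongr
          exact (norm_sub_le _ _).trans (add_le_add (e1.trans hw) (e2.trans hw))
      _ = _ := by ring

/-! ### The primitives and the two integrals. -/

/-- The primitive of `H_{c,h} A_c` that vanishes at `1 / 2`. -/
def primA (c : ℕ) (h : ℝ) : ℂ → ℂ := segmentPrimitive (fun z => confH c h z * magicA c z) (1 / 2)

/-- The primitive of `H_{c,h} B_c` that vanishes at `1 / 2`. -/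
def primB (c : ℕ) (h : ℝ) : ℂ → ℂ := segmentPrimitive (fun z => confH c h z * magicB c z) (1 / 2)

theorem hasDerivAt_primA (c : ℕ) (h : ℝ) {z : ℂ} (hz : z ∈ doublySlitPlane) :
    HasDerivAt (primA c h) (confH c h z * magicA c z) z :=
  hasDerivAt_segmentPrimitive isOpen_doublySlitPlane starConvex_doublySlitPlane
    (fun _ hw => (differentiableAt_confH_mul_magicA c h hw).differentiableWithinAt) hz

theorem hasDerivAt_primB (c : ℕ) (h : ℝ) {z : ℂ} (hz : z ∈ doublySlitPlane) :
    HasDerivAt (primB c h) (confH c h z * magicB c z) z :=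
  hasDerivAt_segmentPrimitive isOpen_doublySlitPlane starConvex_doublySlitPlane
    (fun _ hw => (differentiableAt_confH_mul_magicB c h hw).differentiableWithinAt) hz

theorem primA_conj (c : ℕ) (h : ℝ) {z : ℂ} (hz : z ∈ doublySlitPlane) :
    primA c h ((starRingEnd ℂ) z) = (starRingEnd ℂ) (primA c h z) :=
  segmentPrimitive_conj starConvex_doublySlitPlane (by simp [map_ofNat])
    (fun w hw => by rw [confH_conj _ _ hw, magicA_conj, map_mul]) hz

theorem primB_conj (c : ℕ) (h : ℝ) {z : ℂ} (hz : z ∈ doublySlitPlane) :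
    primB c h ((starRingEnd ℂ) z) = (starRingEnd ℂ) (primB c h z) :=
  segmentPrimitive_conj starConvex_doublySlitPlane (by simp [map_ofNat])
    (fun w hw => by rw [confH_conj _ _ hw, magicB_conj, map_mul]) hz

theorem primA_half (c : ℕ) (h : ℝ) : primA c h (1 / 2) = 0 := segmentPrimitive_self _ _

theorem primB_half (c : ℕ) (h : ℝ) : primB c h (1 / 2) = 0 := segmentPrimitive_self _ _

/-- The difference of the two sides has derivative zero on the convex upper half-plane, by the
identity of differentials. -/
theorem primB_sub_primB {c : ℕ} (hc : c = 8 ∨ c = 24) (h : ℝ) {z w : ℂ} (hz : 0 < z.im)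
    (hw : 0 < w.im) :
    primB c h z - primB c h w = Complex.exp (2 * Real.pi * Complex.I * ((h - c / 16 : ℝ) : ℂ)) *
      (primA c h (z / (z - 1)) - primA c h (w / (w - 1))) := by
  set e := Complex.exp (2 * Real.pi * Complex.I * ((h - c / 16 : ℝ) : ℂ)) with he
  have hconv : Convex ℝ {z : ℂ | 0 < z.im} := convex_halfSpace_im_gt 0
  have hd : ∀ x ∈ segment ℝ w z,
      HasDerivAt (fun x => primB c h x - e * primA c h (x / (x - 1))) 0 x := by
    intro x hx
    have hxi : 0 < x.im := hconv.segment_subset hw hz hx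
    have hU := mem_doublySlitPlane_of_im hxi.ne'
    have h1 : x - 1 ≠ 0 := by
      rw [← neg_sub, neg_ne_zero]; exact doublySlitPlane_one_sub_ne_zero hU
    have hq : HasDerivAt (fun x : ℂ => x / (x - 1)) (-1 / (x - 1) ^ 2) x := by
      refine ((hasDerivAt_id x).div ((hasDerivAt_id x).sub_const 1) h1).congr_deriv ?_
      simp
    have hA := (hasDerivAt_primA c h (mem_doublySlitPlane_of_im (pfaff_im_neg hxi).ne)).comp x hq
    refine ((hasDerivAt_primB c h hU).sub (hA.const_mul e)).congr_deriv ?_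
    rw [confH_mul_magicB hc h hxi, sub_self]
  have := norm_sub_le_of_segment (C := 0) (f := fun _ => 0) hd (by simp)
  rw [zero_mul, norm_le_zero_iff] at this
  linear_combination this

/-- The term H(1-x) A(x) is -H(1-x)(A+B)(1-x), so it integrates to values of `primA` + `primB` near
0. -/
theorem tendsto_first_integral {c : ℕ} (hc : c = 8 ∨ c = 24) {h : ℝ} (hch : (c : ℝ) / 24 ≤ h) :
    Filter.Tendsto (fun x : ℝ => primA c h x - (primA c h (1 - x) + primB c h (1 - x)))
      (nhdsWithin 1 (Iio 1))
      (nhds (∫ x in (1 / 2 : ℝ)..1, slashIdSubS (confH c h) (x : ℂ) * magicA c (x : ℂ))) := by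
  have hder : ∀ x ∈ Ico (1 / 2 : ℝ) 1,
      HasDerivAt (fun x : ℝ => primA c h x - (primA c h (1 - x) + primB c h (1 - x)))
        (slashIdSubS (confH c h) (x : ℂ) * magicA c (x : ℂ)) x := by
    intro x hx
    have hU : (x : ℂ) ∈ doublySlitPlane :=
      mem_doublySlitPlane_of_re (by simp; linarith [hx.1]) (by simpa using hx.2)
    have hV := one_sub_mem_doublySlitPlane hU
    have hl : HasDerivAt (fun x : ℂ => 1 - x) (-1) (x : ℂ) := by
      simpa using (hasDerivAt_id (x : ℂ)).const_sub 1
    have hd := (hasDerivAt_primA c h hU).sub (((hasDerivAt_primA c h hV).comp (x : ℂ) hl).add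
      ((hasDerivAt_primB c h hV).comp (x : ℂ) hl))
    refine hd.comp_ofReal.congr_deriv ?_
    have hr := magicA_add_magicB hc (doublySlitPlane_ne_zero hV)
      (doublySlitPlane_one_sub_ne_zero hV)
    rw [sub_sub_cancel] at hr
    rw [slashIdSubS]
    linear_combination confH c h (1 - x) * hr
  have h0 : Filter.Tendsto (fun x : ℝ => primA c h x - (primA c h (1 - x) + primB c h (1 - x)))
      (nhdsWithin (1 / 2) (Ioi (1 / 2))) (nhds 0) := by
    have := (hder (1 / 2) (by norm_num)).continuousAt.tendsto
    have e1 : ((1 / 2 : ℝ) : ℂ) = 1 / 2 := by push_cast; rfl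
    have e2 : (1 - 1 / 2 : ℂ) = 1 / 2 := by norm_num
    simp only [e1, e2, primA_half, primB_half] at this
    rw [add_zero, sub_zero] at this
    exact this.mono_left nhdsWithin_le_nhds
  have := tendsto_of_hasDerivAt_of_integrable (by norm_num) (fun x hx => hder x ⟨hx.1.le, hx.2⟩)
    (intervalIntegrable_slash_mul_magicA hc hch) h0
  rwa [zero_add] at this

/-- By the invariance of `magicB`, the reflected term is a derivative of `primB` along the conjugate
half-line. -/
theorem tendsto_second_integral {c : ℕ} (hc : c = 8 ∨ c = 24) {h : ℝ} (hch : (c : ℝ) / 24 ≤ h) :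
    Filter.Tendsto (fun T : ℝ => primB c h (1 / 2 + T * Complex.I) +
      primB c h (1 - (1 / 2 + T * Complex.I))) Filter.atTop
      (nhds (∫ t in Ioi (0 : ℝ), slashIdSubS (confH c h) (1 / 2 + (t : ℂ) * Complex.I) *
        magicB c (1 / 2 + (t : ℂ) * Complex.I) * Complex.I)) := by
  have hi := integrableOn_slash_mul_magicB hc hch
  refine (intervalIntegral_tendsto_integral_Ioi 0 hi Filter.tendsto_id).congr' ?_
  filter_upwards [Filter.eventually_ge_atTop 0] with T hT
  have := intervalIntegral.integral_eq_sub_of_hasDerivAt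
    (f := fun T : ℝ => primB c h (1 / 2 + T * Complex.I) +
      primB c h (1 - (1 / 2 + T * Complex.I)))
    (f' := fun t : ℝ => slashIdSubS (confH c h) (1 / 2 + (t : ℂ) * Complex.I) *
        magicB c (1 / 2 + (t : ℂ) * Complex.I) * Complex.I) (a := 0) (b := T)
    (fun t _ => by
      have hU := half_add_mul_I_mem t
      have hV := one_sub_mem_doublySlitPlane hU
      have hl : HasDerivAt (fun t : ℂ => 1 / 2 + t * Complex.I) Complex.I (t : ℂ) := by
        simpa using ((hasDerivAt_id (t : ℂ)).mul_const Complex.I).const_add (1 / 2)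
      have hd := ((hasDerivAt_primB c h hU).comp (t : ℂ) hl).add
        ((hasDerivAt_primB c h hV).comp (t : ℂ) (hl.const_sub 1))
      refine hd.comp_ofReal.congr_deriv ?_
      rw [slashIdSubS, magicB_one_sub hc (doublySlitPlane_ne_zero hU)
        (doublySlitPlane_one_sub_ne_zero hU)]
      ring)
    ((intervalIntegrable_iff_integrableOn_Ioc_of_le hT).2 (hi.mono_set Ioc_subset_Ioi_self))
  have e2 : (1 - 1 / 2 : ℂ) = 1 / 2 := by norm_num
  simp only [Complex.ofReal_zero, zero_mul, add_zero, e2, primB_half, sub_zero] at this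
  exact this

/-! ### Replacing an end point p by its modulus. -/

/-- Re + Im is affine and at least ‖p‖ at both ends of the chord; it is at most 2‖z‖. So the chord
stays away from 0, and the mean value inequality can be used on it. -/
theorem segment_norm_bounds {p z : ℂ} (hr : 0 < p.re) (hi : 0 < p.im)
    (hz : z ∈ segment ℝ (‖p‖ : ℂ) p) : 0 < z.re ∧ ‖z‖ ≤ ‖p‖ ∧ ‖p‖ ≤ 2 * ‖z‖ := by
  have hp : 0 < ‖p‖ := hr.trans_le (Complex.re_le_norm p)
  rw [segment_eq_image] at hz
  obtain ⟨a, ha, rfl⟩ := hz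
  have ha1 : 0 ≤ 1 - a := by linarith [ha.2]
  set z : ℂ := (1 - a) • (‖p‖ : ℂ) + a • p with hz
  have ere : z.re = (1 - a) * ‖p‖ + a * p.re := by simp [hz]
  have eim : z.im = a * p.im := by simp [hz]
  have hsum : ‖p‖ ≤ p.re + p.im := by
    have := Complex.norm_le_abs_re_add_abs_im p
    rwa [abs_of_pos hr, abs_of_pos hi] at this
  refine ⟨?_, ?_, ?_⟩
  · rw [ere]
    rcases ha.1.lt_or_eq with h | h
    · have := mul_nonneg ha1 hp.le
      positivity
    · rw [← h]
      linarith
  · refine (norm_add_le _ _).trans (le_of_eq ?_)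
    rw [norm_smul, norm_smul, Complex.norm_real, norm_norm, Real.norm_of_nonneg ha1,
      Real.norm_of_nonneg ha.1]
    ring
  · have h1 := Complex.re_le_norm z
    have h2 := Complex.im_le_norm z
    have h3 : ‖p‖ ≤ z.re + z.im := by
      rw [ere, eim]
      nlinarith [mul_le_mul_of_nonneg_left hsum ha.1]
    linarith

theorem norm_sub_ofReal_norm_le (p : ℂ) : ‖p - (‖p‖ : ℂ)‖ ≤ 2 * ‖p‖ := by
  refine (norm_sub_le _ _).trans (le_of_eq ?_)
  rw [Complex.norm_real, norm_norm]
  ring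

theorem norm_primA_sub_near_one {c : ℕ} (hc : c = 8 ∨ c = 24) {h : ℝ} (hch : (c : ℝ) / 24 ≤ h)
    {p : ℂ} (hr : 0 < p.re) (hi : 0 < p.im) (hp : ‖p‖ ≤ 1 / 2) :
    ‖primA c h (1 - p) - primA c h (1 - ‖p‖)‖ ≤ 400 * ‖p‖ := by
  have hseg : ∀ z ∈ segment ℝ (‖p‖ : ℂ) p, 0 < z.re ∧ z.re < 1 ∧ ‖z‖ ≤ 1 / 2 := fun z hz => by
    obtain ⟨h1, h2, _⟩ := segment_norm_bounds hr hi hz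
    exact ⟨h1, by linarith [Complex.re_le_norm z], by linarith⟩
  have := norm_sub_le_of_segment (C := 200) (K := fun z => primA c h (1 - z))
    (f := fun z => -(confH c h (1 - z) * magicA c (1 - z)))
    (fun z hz => by
      obtain ⟨h1, h2, _⟩ := hseg z hz
      have hl : HasDerivAt (fun x : ℂ => 1 - x) (-1) z := by
        simpa using (hasDerivAt_id z).const_sub 1
      refine ((hasDerivAt_primA c h (one_sub_mem_doublySlitPlane
        (mem_doublySlitPlane_of_re h1 h2))).comp z hl).congr_deriv (by ring))
    (fun z hz => by
      obtain ⟨h1, h2, h3⟩ := hseg z hz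
      rw [norm_neg]
      exact (norm_confH_mul_magicA_le hc hch (by simpa using h2) (by simpa using h1)
        (by rwa [sub_sub_cancel])).1)
  exact this.trans (by linarith [norm_sub_ofReal_norm_le p])

/-- The primitives are not controlled separately here; the derivative of their sum is -H(z) A(1-z),
which is bounded near 0. -/
theorem norm_primA_add_primB_sub_near_zero {c : ℕ} (hc : c = 8 ∨ c = 24) {h : ℝ}
    (hch : (c : ℝ) / 24 ≤ h) {p : ℂ} (hr : 0 < p.re) (hi : 0 < p.im) (hp : ‖p‖ ≤ 1 / 2) :
    ‖(primA c h p + primB c h p) - (primA c h ‖p‖ + primB c h ‖p‖)‖ ≤ 400 * ‖p‖ := by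
  have hseg : ∀ z ∈ segment ℝ (‖p‖ : ℂ) p, 0 < z.re ∧ z.re < 1 ∧ ‖z‖ ≤ 1 / 2 := fun z hz => by
    obtain ⟨h1, h2, _⟩ := segment_norm_bounds hr hi hz
    exact ⟨h1, by linarith [Complex.re_le_norm z], by linarith⟩
  have := norm_sub_le_of_segment (C := 200) (K := fun z => primA c h z + primB c h z)
    (f := fun z => -(confH c h z * magicA c (1 - z)))
    (fun z hz => by
      obtain ⟨h1, h2, _⟩ := hseg z hz
      have hU := mem_doublySlitPlane_of_re h1 h2
      refine ((hasDerivAt_primA c h hU).add (hasDerivAt_primB c h hU)).congr_deriv ?_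
      linear_combination confH c h z * magicA_add_magicB hc (doublySlitPlane_ne_zero hU)
        (doublySlitPlane_one_sub_ne_zero hU))
    (fun z hz => by
      obtain ⟨h1, h2, h3⟩ := hseg z hz
      rw [norm_neg]
      have := (norm_confH_mul_magicA_le hc hch (z := 1 - z) (by simpa using h2) (by simpa using h1)
        (by rwa [sub_sub_cancel])).2
      rwa [sub_sub_cancel] at this)
  exact this.trans (by linarith [norm_sub_ofReal_norm_le p])

theorem norm_primA_sub_near_zero {c : ℕ} (hc : c = 8 ∨ c = 24) {h : ℝ}
    (hh : (c : ℝ) / 16 + 1 / 2 < h) :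
    ∃ κ : ℝ, 0 < κ ∧ ∃ δ : ℝ, 0 < δ ∧ ∀ p : ℂ, 0 < p.re → 0 < p.im → ‖p‖ < δ →
      ‖primA c h p - primA c h ‖p‖‖ ≤ 300 * ‖p‖ ^ κ := by
  obtain ⟨κ, hκ, δ, hδ, hδ2, hb⟩ := confH_mul_magicA_bound_zero hc hh
  refine ⟨κ, hκ, δ, hδ, fun p hr hi hp => ?_⟩
  have hp0 : 0 < ‖p‖ := hr.trans_le (Complex.re_le_norm p)
  -- On the chord 1/‖z‖ ≤ 2/‖p‖, which turns 75 into 150; the chord length is at most 2‖p‖.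
  have := norm_sub_le_of_segment (C := 150 * ‖p‖ ^ κ / ‖p‖) (K := primA c h)
    (f := fun z => confH c h z * magicA c z) (x := (‖p‖ : ℂ)) (y := p)
    (fun z hz => by
      obtain ⟨h1, h2, _⟩ := segment_norm_bounds hr hi hz
      exact hasDerivAt_primA c h
        (mem_doublySlitPlane_of_re h1 (by linarith [Complex.re_le_norm z])))
    (fun z hz => by
      obtain ⟨h1, h2, h3⟩ := segment_norm_bounds hr hi hz
      have h4 := hb z h1 (h2.trans_lt hp)
      have h5 : ‖z‖ ^ κ ≤ ‖p‖ ^ κ := Real.rpow_le_rpow (norm_nonneg z) h2 hκ.le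
      rw [le_div_iff₀ hp0]
      calc _ ≤ ‖confH c h z * magicA c z‖ * (2 * ‖z‖) := by gcongr
        _ ≤ _ := by linarith)
  refine this.trans ?_
  calc _ ≤ 150 * ‖p‖ ^ κ / ‖p‖ * (2 * ‖p‖) := by
        have := norm_sub_ofReal_norm_le p
        gcongr
    _ = _ := by field_simp; ring

theorem primA_ofReal_im (c : ℕ) (h : ℝ) {x : ℝ} (hx : x ∈ Ioo (0 : ℝ) 1) :
    (primA c h x).im = 0 ∧ (primB c h x).im = 0 := by
  have hU : (x : ℂ) ∈ doublySlitPlane :=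
    mem_doublySlitPlane_of_re (by simpa using hx.1) (by simpa using hx.2)
  have h1 := primA_conj c h hU
  have h2 := primB_conj c h hU
  rw [Complex.conj_ofReal] at h1 h2
  exact ⟨Complex.conj_eq_iff_im.1 h1.symm, Complex.conj_eq_iff_im.1 h2.symm⟩

theorem primA_re_mono {c : ℕ} (hc : c = 8 ∨ c = 24) (h : ℝ) {x y : ℝ} (hx : 0 < x) (hxy : x ≤ y)
    (hy : y < 1) : (primA c h x).re ≤ (primA c h y).re := by
  have hd : ∀ t ∈ Ioo (0 : ℝ) 1,
      HasDerivAt (fun t : ℝ => (primA c h t).re) (confH c h t * magicA c t).re t := fun t ht =>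
    (hasDerivAt_primA c h (mem_doublySlitPlane_of_re (by simpa using ht.1)
      (by simpa using ht.2))).real_of_complex
  have hm : MonotoneOn (fun t : ℝ => (primA c h t).re) (Ioo 0 1) := by
    refine monotoneOn_of_deriv_nonneg (convex_Ioo 0 1)
      (fun t ht => (hd t ht).continuousAt.continuousWithinAt)
      (fun t ht => (hd t (interior_subset ht)).differentiableAt.differentiableWithinAt)
      fun t ht => ?_
    rw [(hd t (interior_subset ht)).deriv]
    obtain ⟨r, hr, er⟩ := confH_ofReal c h (interior_subset ht)
    obtain ⟨r', hr', er'⟩ := magicA_ofReal hc (interior_subset ht)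
    rw [er, er', ← Complex.ofReal_mul, Complex.ofReal_re]
    positivity
  exact hm ⟨hx, hxy.trans_lt hy⟩ ⟨hx.trans_le hxy, hy⟩ hxy

/-! ### The truncated contour. -/

/-- The end point near `0` of the truncated contour; its image under `z ↦ z / (z - 1)` is its
complex conjugate. -/
def cutPoint (T : ℝ) : ℂ := (1 / 2 - T * Complex.I)⁻¹

theorem cutPoint_re_im {T : ℝ} (hT : 0 < T) : 0 < (cutPoint T).re ∧ 0 < (cutPoint T).im := by
  have hn : 0 < Complex.normSq (1 / 2 - T * Complex.I) :=
    Complex.normSq_pos.2 fun h => by simpa using congrArg Complex.re h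
  rw [cutPoint, Complex.inv_re, Complex.inv_im]
  constructor
  · exact div_pos (by simp) hn
  · exact div_pos (by simpa using hT) hn

theorem cutPoint_ne (T : ℝ) :
    (1 / 2 - (T : ℂ) * Complex.I) ≠ 0 ∧ (1 / 2 + (T : ℂ) * Complex.I) ≠ 0 :=
  ⟨fun h => by simpa using congrArg Complex.re h, fun h => by simpa using congrArg Complex.re h⟩

theorem one_sub_cutPoint (T : ℝ) : (1 / 2 + (T : ℂ) * Complex.I) /
    ((1 / 2 + (T : ℂ) * Complex.I) - 1) = 1 - cutPoint T := by
  have h1 := (cutPoint_ne T).1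
  have e : (1 / 2 + (T : ℂ) * Complex.I) - 1 = -(1 / 2 - (T : ℂ) * Complex.I) := by ring
  rw [cutPoint, e, div_neg, eq_sub_iff_add_eq, neg_add_eq_iff_eq_add, inv_eq_iff_eq_inv]
  rw [← inv_eq_iff_eq_inv, inv_eq_one_div, div_eq_iff h1, add_mul, div_mul_cancel₀ _ h1]
  ring

theorem cutPoint_div (T : ℝ) :
    cutPoint T / (cutPoint T - 1) = (starRingEnd ℂ) (cutPoint T) := by
  have h1 := (cutPoint_ne T).1
  have h2 := (cutPoint_ne T).2
  have e : cutPoint T - 1 = (1 / 2 + (T : ℂ) * Complex.I) * cutPoint T := by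
    rw [cutPoint, eq_mul_inv_iff_mul_eq₀ h1, sub_mul, inv_mul_cancel₀ h1]
    ring
  have h3 : cutPoint T ≠ 0 := inv_ne_zero h1
  rw [e, mul_comm, div_mul_eq_div_div, div_self h3, cutPoint, map_inv₀, one_div]
  congr 1
  simp [map_ofNat]

theorem tendsto_norm_cutPoint :
    Filter.Tendsto (fun T => ‖cutPoint T‖) Filter.atTop (nhds 0) := by
  refine squeeze_zero' (Filter.Eventually.of_forall fun T => norm_nonneg _) ?_
    tendsto_inv_atTop_zero
  filter_upwards [Filter.eventually_gt_atTop 0] with T hT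
  rw [cutPoint, norm_inv]
  refine inv_anti₀ hT ?_
  have := Complex.abs_im_le_norm (1 / 2 - (T : ℂ) * Complex.I)
  simp only [Complex.sub_im, Complex.im_ofReal_mul, Complex.I_im] at this
  norm_num at this
  exact (le_abs_self T).trans (by simpa using this)

/-- The functional truncated at `cutPoint T`. -/
def truncF (c : ℕ) (h : ℝ) (T : ℝ) : ℂ :=
  (primA c h (1 - ‖cutPoint T‖) - (primA c h ‖cutPoint T‖ + primB c h ‖cutPoint T‖)) +
    (1 / 2) * (primB c h (1 / 2 + T * Complex.I) + primB c h (1 - (1 / 2 + T * Complex.I)))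

theorem tendsto_truncF {c : ℕ} (hc : c = 8 ∨ c = 24) {h : ℝ} (hch : (c : ℝ) / 24 ≤ h) :
    Filter.Tendsto (truncF c h) Filter.atTop (nhds (contourF c h)) := by
  have h1 : Filter.Tendsto (fun T => 1 - ‖cutPoint T‖) Filter.atTop (nhdsWithin 1 (Iio 1)) := by
    refine tendsto_nhdsWithin_iff.2 ⟨by simpa using tendsto_norm_cutPoint.const_sub 1, ?_⟩
    filter_upwards with T
    have : 0 < ‖cutPoint T‖ := norm_pos_iff.2 (inv_ne_zero (cutPoint_ne T).1)
    exact sub_lt_self 1 this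
  refine (((tendsto_first_integral hc hch).comp h1).add
    ((tendsto_second_integral hc hch).const_mul (1 / 2))).congr fun T => ?_
  simp only [Function.comp_apply, truncF]
  push_cast
  rw [sub_sub_cancel]

/-- The ends 1/2 ± iT are conjugate, so half the sum of the two values of `primB` is a real part.
That value is moved to `cutPoint T` and transformed into values of `primA`. -/
theorem truncF_eq {c : ℕ} (hc : c = 8 ∨ c = 24) (h : ℝ) {T : ℝ} (hT : 0 < T)
    (hp : ‖cutPoint T‖ ≤ 1 / 2) :
    (truncF c h T).im = 0 ∧
    (truncF c h T).re = ((primA c h (1 - ‖cutPoint T‖) -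
      (primA c h ‖cutPoint T‖ + primB c h ‖cutPoint T‖)) + primB c h (cutPoint T) +
      Complex.exp (2 * Real.pi * Complex.I * ((h - c / 16 : ℝ) : ℂ)) *
        (primA c h (1 - cutPoint T) - primA c h ((starRingEnd ℂ) (cutPoint T)))).re := by
  obtain ⟨hr, hi⟩ := cutPoint_re_im hT
  have hp0 : 0 < ‖cutPoint T‖ := hr.trans_le (Complex.re_le_norm _)
  set q := ‖cutPoint T‖ with hq
  obtain ⟨a1, b1⟩ := primA_ofReal_im c h (x := q) ⟨hp0, by linarith⟩
  obtain ⟨a2, -⟩ := primA_ofReal_im c h (x := 1 - q) ⟨by linarith, by linarith⟩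
  push_cast at a2
  have hcz : 1 - (1 / 2 + (T : ℂ) * Complex.I) = (starRingEnd ℂ) (1 / 2 + T * Complex.I) := by
    simp only [map_add, map_div₀, map_one, map_ofNat, map_mul, Complex.conj_ofReal, Complex.conj_I]
    ring
  have hcB := primB_conj c h (half_add_mul_I_mem T)
  rw [← hcz] at hcB
  have hsum : (1 / 2 : ℂ) * (primB c h (1 / 2 + T * Complex.I) +
      primB c h (1 - (1 / 2 + T * Complex.I))) =
      ((primB c h (1 / 2 + T * Complex.I)).re : ℂ) := by
    rw [hcB, Complex.add_conj]
    push_cast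
    ring
  have hrel := primB_sub_primB hc h (z := 1 / 2 + T * Complex.I) (w := cutPoint T)
    (by simpa using hT) hi
  rw [one_sub_cutPoint, cutPoint_div] at hrel
  rw [truncF, hsum, ← hrel, ← hq]
  constructor
  · simp [a1, b1, a2]
  · simp only [Complex.add_re, Complex.sub_re, Complex.ofReal_re]
    ring

theorem norm_exp_phase (x : ℝ) : ‖Complex.exp (2 * Real.pi * Complex.I * (x : ℂ))‖ = 1 := by
  rw [show 2 * (Real.pi : ℂ) * Complex.I * (x : ℂ) = ((2 * Real.pi * x : ℝ) : ℂ) * Complex.I by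
    push_cast; ring, Complex.norm_exp_ofReal_mul_I]

theorem contourF_im {c : ℕ} (hc : c = 8 ∨ c = 24) {h : ℝ} (hch : (c : ℝ) / 24 ≤ h) :
    (contourF c h).im = 0 := by
  refine tendsto_nhds_unique ((Complex.continuous_im.tendsto _).comp (tendsto_truncF hc hch))
    (tendsto_const_nhds.congr' ?_)
  filter_upwards [Filter.eventually_gt_atTop 0,
    tendsto_norm_cutPoint.eventually (Iic_mem_nhds (by norm_num : (0 : ℝ) < 1 / 2))] with T hT hp
  exact (truncF_eq hc h hT hp).1.symm

/-- The real part of the truncated functional, up to an error that tends to zero. -/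
theorem abs_truncF_re_sub_le {c : ℕ} (hc : c = 8 ∨ c = 24) {h : ℝ} (hch : (c : ℝ) / 24 ≤ h)
    {T : ℝ} (hT : 0 < T) (hp : ‖cutPoint T‖ ≤ 1 / 2) :
    |(truncF c h T).re - ((primA c h (1 - ‖cutPoint T‖) - primA c h (cutPoint T)) +
      Complex.exp (2 * Real.pi * Complex.I * ((h - c / 16 : ℝ) : ℂ)) *
        (primA c h (1 - ‖cutPoint T‖) - primA c h ((starRingEnd ℂ) (cutPoint T)))).re| ≤
      800 * ‖cutPoint T‖ := by
  obtain ⟨hr, hi⟩ := cutPoint_re_im hT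
  have e1 := norm_primA_sub_near_one hc hch hr hi hp
  have e2 := norm_primA_add_primB_sub_near_zero hc hch hr hi hp
  rw [(truncF_eq hc h hT hp).2, ← Complex.sub_re]
  refine (Complex.abs_re_le_norm _).trans ?_
  have hn := norm_exp_phase (h - c / 16)
  set e := Complex.exp (2 * Real.pi * Complex.I * ((h - c / 16 : ℝ) : ℂ))
  have e3 : ‖e * (primA c h (1 - cutPoint T) - primA c h (1 - ‖cutPoint T‖))‖ ≤
      400 * ‖cutPoint T‖ := by rwa [norm_mul, hn, one_mul]
  -- The error is the sum of the increment of `primA` + `primB` near 0 and e times that of `primA`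
  -- near 1, each at most 400‖p‖.
  refine le_trans (le_of_eq ?_) ((norm_add_le _ _).trans (add_le_add e2 e3) |>.trans (by linarith))
  congr 1
  ring

/-! ### Vanishing and positivity. -/

/-- With phase -1 the values at 1-‖p‖ cancel, and a number minus its conjugate has real part zero;
no bound on `primA` near 0 is needed. -/
theorem contourF_eq_zero {c : ℕ} (hc : c = 8 ∨ c = 24) (n : ℕ) :
    contourF c ((c : ℝ) / 16 + 1 / 2 + n) = 0 := by
  set h : ℝ := (c : ℝ) / 16 + 1 / 2 + n with hh
  have hc0 : (0 : ℝ) ≤ c := Nat.cast_nonneg c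
  have hc24 : (c : ℝ) ≤ 24 := by rcases hc with rfl | rfl <;> norm_num
  have hn0 : (0 : ℝ) ≤ n := Nat.cast_nonneg n
  have hch : (c : ℝ) / 24 ≤ h := by rw [hh]; linarith
  have he : Complex.exp (2 * Real.pi * Complex.I * ((h - c / 16 : ℝ) : ℂ)) = -1 := by
    rw [show 2 * (Real.pi : ℂ) * Complex.I * ((h - c / 16 : ℝ) : ℂ) =
      Real.pi * Complex.I + n * (2 * Real.pi * Complex.I) by rw [hh]; push_cast; ring,
      Complex.exp_add, Complex.exp_pi_mul_I, Complex.exp_nat_mul_two_pi_mul_I, mul_one]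
  refine Complex.ext ?_ (contourF_im hc hch)
  refine tendsto_nhds_unique ((Complex.continuous_re.tendsto _).comp (tendsto_truncF hc hch)) ?_
  refine squeeze_zero_norm' (a := fun T => 800 * ‖cutPoint T‖) ?_
    (by simpa using tendsto_norm_cutPoint.const_mul 800)
  filter_upwards [Filter.eventually_gt_atTop 0,
    tendsto_norm_cutPoint.eventually (Iic_mem_nhds (by norm_num : (0 : ℝ) < 1 / 2))] with T hT hp
  have hb := abs_truncF_re_sub_le hc hch hT hp
  rw [he, primA_conj c h (mem_doublySlitPlane_of_im (cutPoint_re_im hT).2.ne')] at hb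
  simpa using hb

theorem contourF_re_nonneg {c : ℕ} (hc : c = 8 ∨ c = 24) {h : ℝ}
    (hh : (c : ℝ) / 16 + 1 / 2 < h) : 0 ≤ (contourF c h).re := by
  have hc0 : (0 : ℝ) ≤ c := Nat.cast_nonneg c
  have hc24 : (c : ℝ) ≤ 24 := by rcases hc with rfl | rfl <;> norm_num
  have hch : (c : ℝ) / 24 ≤ h := by linarith
  obtain ⟨κ, hκ, δ, hδ, hb⟩ := norm_primA_sub_near_zero hc hh
  have hre := (Complex.continuous_re.tendsto _).comp (tendsto_truncF hc hch)
  -- 800 is the truncation error; 600 is 300 for replacing `primA` at the cut point and 300 for its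
  -- conjugate.
  have herr : Filter.Tendsto (fun T => 800 * ‖cutPoint T‖ + 600 * ‖cutPoint T‖ ^ κ) Filter.atTop
      (nhds 0) := by
    have h1 := tendsto_norm_cutPoint.rpow_const (p := κ) (Or.inr hκ.le)
    rw [Real.zero_rpow hκ.ne'] at h1
    simpa using (tendsto_norm_cutPoint.const_mul 800).add (h1.const_mul 600)
  have hsum := hre.add herr
  rw [add_zero] at hsum
  refine ge_of_tendsto hsum ?_
  filter_upwards [Filter.eventually_gt_atTop 0,
    tendsto_norm_cutPoint.eventually (Iic_mem_nhds (by norm_num : (0 : ℝ) < 1 / 4)),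
    tendsto_norm_cutPoint.eventually (Iio_mem_nhds hδ)] with T hT hp hpδ
  have hp' : ‖cutPoint T‖ ≤ 1 / 4 := hp
  obtain ⟨hr, hi⟩ := cutPoint_re_im hT
  have hp0 : 0 < ‖cutPoint T‖ := hr.trans_le (Complex.re_le_norm _)
  have h1 := (abs_le.1 (abs_truncF_re_sub_le hc hch hT (by linarith))).1
  have h2 := hb _ hr hi hpδ
  have hU := mem_doublySlitPlane_of_im hi.ne'
  rw [primA_conj c h hU] at h1
  have hn := norm_exp_phase (h - c / 16)
  set e := Complex.exp (2 * Real.pi * Complex.I * ((h - c / 16 : ℝ) : ℂ))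
  set q := ‖cutPoint T‖ with hq
  obtain ⟨a1, -⟩ := primA_ofReal_im c h (x := q) ⟨hp0, by linarith⟩
  obtain ⟨a2, -⟩ := primA_ofReal_im c h (x := 1 - q) ⟨by linarith, by linarith⟩
  have hmono := primA_re_mono hc h (x := q) (y := 1 - q) hp0 (by linarith) (by linarith)
  push_cast at a2 hmono
  have hreal : (starRingEnd ℂ) (primA c h q) = primA c h q := Complex.conj_eq_iff_im.2 a1
  have h3 : ‖e * (starRingEnd ℂ) (primA c h (cutPoint T) - primA c h q)‖ ≤ 300 * q ^ κ := by
    rwa [norm_mul, hn, one_mul, Complex.norm_conj]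
  have h2' := (abs_le.1 ((Complex.abs_re_le_norm _).trans h2)).2
  have h3' := (abs_le.1 ((Complex.abs_re_le_norm _).trans h3)).2
  rw [map_sub, hreal] at h3'
  have her : -1 ≤ e.re := (abs_le.1 ((Complex.abs_re_le_norm e).trans hn.le)).1
  -- The main term: |e| = 1 gives 1 + Re e ≥ 0, and `primA` increases on (0,1) because `confH` and
  -- `magicA` are non-negative there.
  have hmain : 0 ≤ (1 + e.re) * ((primA c h (1 - q)).re - (primA c h q).re) :=
    mul_nonneg (by linarith) (by linarith)
  simp only [Complex.add_re, Complex.sub_re, Complex.mul_re, Complex.sub_im, a1, a2] at h1 h2' h3'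
  simp only [Function.comp_apply]
  nlinarith

end

theorem theorem6p6 (c : ℕ) (hc : c = 8 ∨ c = 24) :
    (∀ h : ℝ, (c : ℝ) / 16 + 1 / 2 ≤ h →
      ContourDExists c (slashIdSubS (confH c h)) ∧
        (contourF c h).im = 0 ∧ 0 ≤ (contourF c h).re) ∧
    (∀ n : ℕ, contourF c ((c : ℝ) / 16 + 1 / 2 + n) = 0) := by
  refine ⟨fun h hh => ?_, contourF_eq_zero hc⟩
  have hc24 : (c : ℝ) ≤ 24 := by rcases hc with rfl | rfl <;> norm_num
  have hch : (c : ℝ) / 24 ≤ h := by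
    have hc0 : (0 : ℝ) ≤ c := Nat.cast_nonneg c
    linarith
  refine ⟨⟨intervalIntegrable_slash_mul_magicA hc hch, integrableOn_slash_mul_magicB hc hch⟩,
    contourF_im hc hch, ?_⟩
  -- At the threshold the exponent κ degenerates to 0 and the positivity argument fails, but there
  -- the value is the zero with n = 0.
  rcases hh.lt_or_eq with hlt | rfl
  · exact contourF_re_nonneg hc hlt
  · have := contourF_eq_zero hc 0
    rw [Nat.cast_zero, add_zero] at this
    exact (congrArg Complex.re this).ge
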